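/- Let $n\ge 1$, $0<p<\infty$ and $0<r\le p$. A cube is a compact cube in $\mathbb R^n$ with sides parallel to the coordinate axes; $c(Q)$, $\ell(Q)$, $|Q|$ denote the centre, side-length and volume of a cube $Q$. For $\phi:\mathbb R^n\times(0,\infty)\to(0,\infty)$ and measurable $g$ put $$\|g\|_{\mathcal M_{p,\phi}}=\sup_{Q}\frac1{\phi(c(Q),\ell(Q))}\Big(\frac1{|Q|}\int_Q|g(y)|^p\,dy\Big)^{1/p},\qquad \|g\|_{W\mathcal M_{p,\phi}}=\sup_{T>0}T\,\|\chi_{\{|g|>T\}}\|_{\mathcal M_{p,\phi}},$$ the supremum being taken over all cubes $Q$; $\mathcal M_{p,\phi}(\mathbb R^n)$ consists of all measurable $g$ with $\|g\|_{\mathcal M_{p,\phi}}<\infty$. Let $\phi_1,\phi_2:\mathbb R^n\times(0,\infty)\to(0,\infty)$ be such that for some constant $A$ and all $x\in\mathbb R^n$, $t>0$, $$\sup_{\tau>t}\Big[\Big(\inf_{\tau<s<\infty}\phi_1(x,s)^r s^{nr/p}\Big)\tau^{-nr/p}\Big]\le A\,\phi_2(x,t)^r$$ (equivalently, $\sup_{\tau>t}\inf_{s>\tau}\phi_1(x,s)s^{n/p}\tau^{-n/p}\le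 A^{1/r}\phi_2(x,t)$). Let $d\ge0$. Then there is a constant $C$, depending only on $n,p,r,\phi_1,\phi_2$ and $d$, such that for every compact set $\Omega\subset\mathbb R^n$ of diameter $d$ and every $f\in\mathcal M_{p,\phi_1}(\mathbb R^n)$ which is a tempered distribution with $\operatorname{supp}\mathcal Ff\subset\Omega$ (and is taken to be the continuous function representing it) the following hold. (1) If $r<p$, then $$\Big\|\sup_{y\in\mathbb R^n}\frac{|f(\cdot-y)|}{1+d|y|^{n/r}}\Big\|_{\mathcal M_{p,\phi_2}}\le C\,\|f\|_{\mathcal M_{p,\phi_1}}.$$ (2) If $p=r$, then $$\Big\|\sup_{y\in\mathbb R^n}\frac{|f(\cdot-y)|}{1+d|y|^{n/r}}\Big\|_{W\mathcal M_{r,\phi_2}}\le C\,\|f\|_{\mathcal M_{r,\phi_1}}.$$ -/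

import Mathlib

open scoped NNReal ENNReal SchwartzMap FourierTransform
open MeasureTheory

noncomputable section

namespace GenMorrey

/-- The Euclidean space `ℝⁿ`. -/
abbrev Rn (n : ℕ) := EuclideanSpace ℝ (Fin n)

/-- The compact cube with centre `x`, side-length `ℓ` and sides parallel to the axes. -/
def cube {n : ℕ} (x : Rn n) (ℓ : ℝ) : Set (Rn n) :=
  {y | ∀ i, |y i - x i| ≤ ℓ / 2}

/-- The generalized Morrey (quasi-)norm of a function with values in `[0, ∞]`: the supremum over
all cubes `Q`, with centre `x` and side-length `ℓ > 0`, of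
`φ(x, ℓ)⁻¹ (|Q|⁻¹ ∫_Q g ^ p) ^ (1 / p)`. -/
def morreyNorm {n : ℕ} (p : ℝ) (φ : Rn n → ℝ → ℝ) (g : Rn n → ℝ≥0∞) : ℝ≥0∞ :=
  ⨆ (x : Rn n) (ℓ : ℝ) (_ : 0 < ℓ),
    (ENNReal.ofReal (φ x ℓ))⁻¹ *
      ((volume (cube x ℓ))⁻¹ * ∫⁻ y in cube x ℓ, g y ^ p) ^ (1 / p)

/-- The weak generalized Morrey (quasi-)norm `sup_{T > 0} T ‖χ_{g > T}‖_{M_{p,φ}}`. -/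
def weakMorreyNorm {n : ℕ} (p : ℝ) (φ : Rn n → ℝ → ℝ) (g : Rn n → ℝ≥0∞) : ℝ≥0∞ :=
  ⨆ (T : ℝ) (_ : 0 < T),
    ENNReal.ofReal T *
      morreyNorm p φ (Set.indicator {x | ENNReal.ofReal T < g x} (fun _ => 1))

/-- Membership of a complex-valued function in the generalized Morrey space `M_{p,φ}(ℝⁿ)`. -/
def MemMorrey {n : ℕ} (p : ℝ) (φ : Rn n → ℝ → ℝ) (f : Rn n → ℂ) : Prop :=
  AEStronglyMeasurable f volume ∧ morreyNorm p φ (fun x => ‖f x‖ₑ) < ∞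

/-- The supremal condition on the pair `(φ₁, φ₂)`, with a constant independent of `x` and `t`:
`sup_{τ > t} [(inf_{s > τ} φ₁(x,s)^r s^{nr/p}) τ^{-nr/p}] ≤ A φ₂(x,t)^r`. -/
def SupremalCondition {n : ℕ} (p r : ℝ) (φ₁ φ₂ : Rn n → ℝ → ℝ) : Prop :=
  ∃ A : ℝ≥0, ∀ (x : Rn n) (t : ℝ), 0 < t →
    (⨆ (τ : ℝ) (_ : t < τ),
      (⨅ (s : ℝ) (_ : τ < s), ENNReal.ofReal (φ₁ x s ^ r * s ^ ((n : ℝ) * r / p))) *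
        ENNReal.ofReal (τ ^ (-((n : ℝ) * r / p))))
      ≤ A * ENNReal.ofReal (φ₂ x t ^ r)

/-- The tempered distribution `T` is the function `f`: `T ψ = ∫ ψ f`, absolutely convergent, for
all Schwartz functions `ψ`. -/
def IsGivenBy {n : ℕ} (T : 𝓢'(Rn n, ℂ)) (f : Rn n → ℂ) : Prop :=
  ∀ ψ : 𝓢(Rn n, ℂ), Integrable (fun x => ψ x * f x) ∧ T ψ = ∫ x, ψ x * f x

/-- `f` is a continuous function which is a tempered distribution with `supp 𝓕 f ⊆ Ω`.
(A tempered distribution whose Fourier transform has compact support is a smooth function of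
polynomial growth; continuity selects that pointwise representative.) -/
def IsBandLimited {n : ℕ} (Ω : Set (Rn n)) (f : Rn n → ℂ) : Prop :=
  Continuous f ∧ ∃ T : 𝓢'(Rn n, ℂ), IsGivenBy T f ∧ Distribution.dsupport (𝓕 T : 𝓢'(Rn n, ℂ)) ⊆ Ω

/-- The Peetre maximal function `x ↦ sup_y |f(x - y)| / (1 + d |y|^{n/r})`, in `[0, ∞]`. -/
def peetreMaximal {n : ℕ} (d r : ℝ) (f : Rn n → ℂ) (x : Rn n) : ℝ≥0∞ :=
  ⨆ y : Rn n, ENNReal.ofReal (‖f (x - y)‖ / (1 + d * ‖y‖ ^ ((n : ℝ) / r)))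

end GenMorrey

end

/-! The Peetre maximal function is dominated pointwise by (M|f|^r)^{1/r}, where M is the
Hardy–Littlewood maximal operator, and this operator maps the first Morrey space to the second,
weakly when r = p.

Pointwise bound (`exists_peetreMaximal_le`). An integrable function F with spectrum in a ball of
radius 2δ is its own convolution with a Schwartz kernel at scale 1/δ, so |F| ≤ C |F| * K. This
passes to r-th powers: for r ≥ 1 by Jensen, for r ≤ 1 by bounding |F|^{1-r} through a weighted
supremum of |F| and absorbing it, which requires that supremum to be finite. Since f itself may
grow, the argument is run on products of f with Fourier transforms of shrinking bumps; these are
integrable, enlarge the spectrum only slightly and tend to f. A dyadic decomposition of K then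
yields |f(x - y)|^r ≤ C (1 + δ|y|)^n M(|f|^r)(x). The constant is independent of δ, which is what
makes d = 0 accessible.

Morrey bound. For x in a cube Q of side ℓ, balls of radius at most ℓ containing x stay in 5Q, where
the strong (p/r, p/r) or weak (1, 1) inequality applies. Larger balls lie in larger cubes concentric
with Q. The integral of |f|^p over such a cube of side τ is bounded by the integral over the one of
side s, for every s > τ; optimising in s produces exactly the infimum in the supremal condition
(`SupremalCondition.exists_setLIntegral_cube_le`). -/

noncomputable section

namespace GenMorrey

open Metric Set

variable {n : ℕ}

/-! ### The Hardy–Littlewood maximal function: weak and strong type inequalities. -/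

/-- The uncentred Hardy–Littlewood maximal function over Euclidean balls, with the averages
normalised by `ρ ^ n` instead of the volume of the ball of radius `ρ`. -/
def maximalFn (u : Rn n → ℝ≥0∞) (x : Rn n) : ℝ≥0∞ :=
  ⨆ (c : Rn n) (ρ : ℝ) (_ : 0 < ρ) (_ : x ∈ ball c ρ),
    (ENNReal.ofReal (ρ ^ n))⁻¹ * ∫⁻ y in ball c ρ, u y

lemma lt_maximalFn_iff {u : Rn n → ℝ≥0∞} {x : Rn n} {T : ℝ≥0∞} :
    T < maximalFn u x ↔ ∃ c ρ, 0 < ρ ∧ x ∈ ball c ρ ∧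
      T < (ENNReal.ofReal (ρ ^ n))⁻¹ * ∫⁻ y in ball c ρ, u y := by
  simp only [maximalFn, lt_iSup_iff, exists_prop]

lemma average_le_maximalFn (u : Rn n → ℝ≥0∞) {x c : Rn n} {ρ : ℝ} (hρ : 0 < ρ)
    (hx : x ∈ ball c ρ) :
    (ENNReal.ofReal (ρ ^ n))⁻¹ * ∫⁻ y in ball c ρ, u y ≤ maximalFn u x :=
  le_iSup₂_of_le c ρ <| le_iSup₂_of_le hρ hx le_rfl

lemma setLIntegral_ball_le_maximalFn (u : Rn n → ℝ≥0∞) {x c : Rn n} {ρ : ℝ} (hρ : 0 < ρ)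
    (hx : x ∈ ball c ρ) :
    ∫⁻ y in ball c ρ, u y ≤ ENNReal.ofReal (ρ ^ n) * maximalFn u x := by
  have h := average_le_maximalFn u hρ hx
  rwa [mul_comm, ← div_eq_mul_inv, ENNReal.div_le_iff (by simpa using by positivity)
    ENNReal.ofReal_ne_top, mul_comm] at h

lemma maximalFn_le {u : Rn n → ℝ≥0∞} {x : Rn n} {B : ℝ≥0∞}
    (h : ∀ c ρ, 0 < ρ → x ∈ ball c ρ →
      (ENNReal.ofReal (ρ ^ n))⁻¹ * ∫⁻ y in ball c ρ, u y ≤ B) : maximalFn u x ≤ B :=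
  iSup₂_le fun c ρ => iSup₂_le fun hρ hx => h c ρ hρ hx

lemma maximalFn_mono {u v : Rn n → ℝ≥0∞} (h : u ≤ v) (x : Rn n) :
    maximalFn u x ≤ maximalFn v x :=
  maximalFn_le fun _ _ hρ hx =>
    (mul_le_mul_right (lintegral_mono h) _).trans (average_le_maximalFn v hρ hx)

lemma isOpen_lt_maximalFn (u : Rn n → ℝ≥0∞) (T : ℝ≥0∞) : IsOpen {x | T < maximalFn u x} := by
  rw [isOpen_iff_mem_nhds]
  intro x hx
  obtain ⟨c, ρ, hρ, hxc, hT⟩ := lt_maximalFn_iff.1 hx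
  filter_upwards [isOpen_ball.mem_nhds hxc] with z hz
  exact lt_maximalFn_iff.2 ⟨c, ρ, hρ, hz, hT⟩

lemma measurable_maximalFn (u : Rn n → ℝ≥0∞) : Measurable (maximalFn u) :=
  measurable_of_Ioi fun T => (isOpen_lt_maximalFn u T).measurableSet

lemma volume_ball_eq (c : Rn n) {ρ : ℝ} (hρ : 0 < ρ) :
    volume (ball c ρ) = ENNReal.ofReal (ρ ^ n) * volume (ball (0 : Rn n) 1) := by
  simpa using Measure.addHaar_ball_of_pos (volume : Measure (Rn n)) c hρ

/-- The weak type `(1, 1)` inequality for the maximal function. -/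
lemma mul_volume_lt_maximalFn_le (hn : n ≠ 0) (u : Rn n → ℝ≥0∞) (T : ℝ≥0∞) :
    T * volume {x | T < maximalFn u x} ≤
      5 ^ n * volume (ball (0 : Rn n) 1) * ∫⁻ y, u y := by
  have hκ : volume (ball (0 : Rn n) 1) ≠ 0 := (measure_ball_pos _ _ one_pos).ne'
  rcases eq_or_ne T 0 with rfl | hT0
  · simp
  rcases eq_or_ne T ∞ with rfl | hT
  · simp
  rcases eq_or_ne (∫⁻ y, u y) ∞ with hI | hI
  · rw [hI, ENNReal.mul_top (by positivity)]; exact le_top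
  set t : Set (Rn n × ℝ) := {a | 0 < a.2 ∧
    T < (ENNReal.ofReal (a.2 ^ n))⁻¹ * ∫⁻ y in ball a.1 a.2, u y} with ht
  have hmul : ∀ a ∈ t, T * ENNReal.ofReal (a.2 ^ n) ≤ ∫⁻ y in ball a.1 a.2, u y := by
    rintro ⟨c, ρ⟩ ⟨hρ, h⟩
    have h' := h.le
    rwa [mul_comm (ENNReal.ofReal _)⁻¹, ← div_eq_mul_inv,
      ENNReal.le_div_iff_mul_le (.inl (by simpa using by exact pow_pos hρ n))
        (.inl ENNReal.ofReal_ne_top)] at h'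
  -- Vitali's lemma needs bounded radii: ρ ^ n ≤ (∫ u) / T on `t`, and ρ ≤ ρ ^ n once ρ ≥ 1.
  have hR : ∀ a ∈ t, a.2 ≤ max 1 ((∫⁻ y, u y) / T).toReal := by
    intro a ha
    by_cases h1 : a.2 ≤ 1
    · exact h1.trans (le_max_left _ _)
    refine le_max_of_le_right ?_
    have h2 : ENNReal.ofReal (a.2 ^ n) ≤ (∫⁻ y, u y) / T := by
      rw [ENNReal.le_div_iff_mul_le (.inl hT0) (.inl hT), mul_comm]
      exact (hmul a ha).trans (setLIntegral_le_lintegral _ _)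
    have h3 := (ENNReal.ofReal_le_iff_le_toReal (ENNReal.div_ne_top hI hT0)).1 h2
    exact (le_self_pow₀ (not_le.1 h1).le hn).trans h3
  obtain ⟨v, hvt, hvd, hcov⟩ := Vitali.exists_disjoint_subfamily_covering_enlargement_ball t
    Prod.fst Prod.snd _ hR 5 (by norm_num)
  -- Disjoint nonempty open sets in a separable space.
  have hvc : v.Countable := hvd.countable_of_isOpen (fun _ _ => isOpen_ball)
    fun a ha => ⟨a.1, mem_ball_self (hvt ha).1⟩
  have hsub : {x | T < maximalFn u x} ⊆ ⋃ b ∈ v, ball b.1 (5 * b.2) := by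
    intro x hx
    obtain ⟨c, ρ, hρ, hxc, h⟩ := lt_maximalFn_iff.1 hx
    obtain ⟨b, hb, hbs⟩ := hcov (c, ρ) ⟨hρ, h⟩
    exact mem_biUnion hb (hbs hxc)
  calc T * volume {x | T < maximalFn u x}
      ≤ T * ∑' b : v, volume (ball b.1.1 (5 * b.1.2)) := by
        gcongr
        exact (measure_mono hsub).trans (measure_biUnion_le _ hvc _)
    _ = ∑' b : v, 5 ^ n * volume (ball (0 : Rn n) 1) * (T * ENNReal.ofReal (b.1.2 ^ n)) := by
        rw [← ENNReal.tsum_mul_left]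
        refine tsum_congr fun b => ?_
        have hb := (hvt b.2).1
        rw [volume_ball_eq _ (by positivity), mul_pow, ENNReal.ofReal_mul (by positivity),
          ENNReal.ofReal_pow (by norm_num)]
        norm_num
        ring
    _ ≤ ∑' b : v, 5 ^ n * volume (ball (0 : Rn n) 1) * ∫⁻ y in ball b.1.1 b.1.2, u y := by
        gcongr with b
        exact hmul b.1 (hvt b.2)
    _ = 5 ^ n * volume (ball (0 : Rn n) 1) * ∫⁻ y in ⋃ b ∈ v, ball b.1 b.2, u y := by
        rw [ENNReal.tsum_mul_left, lintegral_biUnion hvc (fun _ _ => measurableSet_ball) hvd]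
    _ ≤ _ := by
        exact mul_le_mul_right (setLIntegral_le_lintegral _ _) _

/-- Truncation u ≤ T + u·1_{u > T}. Averages are normalised by ρ ^ n, so the constant T contributes
T times the volume of the unit ball. -/
lemma maximalFn_le_add (u : Rn n → ℝ≥0∞) (T : ℝ≥0∞) (x : Rn n) :
    maximalFn u x ≤ volume (ball (0 : Rn n) 1) * T +
      maximalFn ({y | T < u y}.indicator u) x := by
  refine maximalFn_le fun c ρ hρ hx => ?_
  have h1 : ∀ y, u y ≤ T + {y | T < u y}.indicator u y := by
    intro y
    by_cases h : T < u y
    · simp [indicator, h]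
    · exact (not_lt.1 h).trans le_self_add
  have hρ0 : ENNReal.ofReal (ρ ^ n) ≠ 0 := by simpa using by positivity
  calc _ ≤ (ENNReal.ofReal (ρ ^ n))⁻¹ * ∫⁻ y in ball c ρ, (T + {y | T < u y}.indicator u y) := by
        gcongr with y; exact h1 y
    _ = volume (ball (0 : Rn n) 1) * T +
        (ENNReal.ofReal (ρ ^ n))⁻¹ * ∫⁻ y in ball c ρ, {y | T < u y}.indicator u y := by
        rw [lintegral_add_left measurable_const, setLIntegral_const, volume_ball_eq _ hρ, mul_add]
        congr 1
        rw [mul_comm T, ← mul_assoc, ← mul_assoc, ENNReal.inv_mul_cancel hρ0 ENNReal.ofReal_ne_top,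
          one_mul]
    _ ≤ _ := by gcongr; exact average_le_maximalFn _ hρ hx

/-- Truncating at T uses up half of the level 2κT, with κ the volume of the unit ball; the weak (1,
1) inequality at level κT handles the other half, and κ cancels. -/
lemma volume_lt_maximalFn_le (hn : n ≠ 0) (u : Rn n → ℝ≥0∞) {T : ℝ≥0∞} (hT0 : T ≠ 0)
    (hT : T ≠ ∞) :
    volume {x | 2 * volume (ball (0 : Rn n) 1) * T < maximalFn u x} ≤
      5 ^ n * T⁻¹ * ∫⁻ y, {y | T < u y}.indicator u y := by
  set κ := volume (ball (0 : Rn n) 1) with hκdef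
  have hκ : κ ≠ 0 := (measure_ball_pos _ _ one_pos).ne'
  have hκ' : κ ≠ ∞ := measure_ball_lt_top.ne
  have hκT : κ * T ≠ ∞ := ENNReal.mul_ne_top hκ' hT
  have hsub : {x | 2 * κ * T < maximalFn u x} ⊆
      {x | κ * T < maximalFn ({y | T < u y}.indicator u) x} := by
    intro x hx
    have h := lt_of_lt_of_le hx (maximalFn_le_add u T x)
    rw [mul_assoc, two_mul] at h
    exact (ENNReal.add_lt_add_iff_left hκT).1 h
  have h := (mul_le_mul_right (measure_mono (μ := volume) hsub) _).trans
    (mul_volume_lt_maximalFn_le hn ({y | T < u y}.indicator u) (κ * T))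
  rw [mul_comm (κ * T), ← ENNReal.le_div_iff_mul_le (.inl (by positivity)) (.inl hκT)] at h
  refine h.trans_eq ?_
  rw [div_eq_mul_inv, ENNReal.mul_inv (.inl hκ) (.inl hκ')]
  calc _ = (κ * κ⁻¹) * (5 ^ n * T⁻¹ * ∫⁻ y, {y | T < u y}.indicator u y) := by ring
    _ = _ := by rw [ENNReal.mul_inv_cancel hκ hκ', one_mul]

/-- The layer-cake formula for a Dirac mass, giving a pointwise identity. It is extended to the
value ∞ and then integrated by Tonelli, because `maximalFn` may be infinite. -/
lemma ofReal_rpow_eq_lintegral {q : ℝ} (hq : 0 < q) {a : ℝ} (ha : 0 ≤ a) :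
    ENNReal.ofReal a ^ q = ENNReal.ofReal q * ∫⁻ t in Ioi (0 : ℝ),
      {t | ENNReal.ofReal t < ENNReal.ofReal a}.indicator (fun t => ENNReal.ofReal (t ^ (q - 1))) t := by
  have h := lintegral_rpow_eq_lintegral_meas_lt_mul (Measure.dirac ()) (f := fun _ => a)
    (Filter.Eventually.of_forall fun _ => ha) measurable_const.aemeasurable hq
  rw [lintegral_dirac] at h
  rw [ENNReal.ofReal_rpow_of_nonneg ha hq.le, h]
  congr 1
  refine setLIntegral_congr_fun measurableSet_Ioi fun t ht => ?_
  have ht : 0 < t := ht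
  by_cases hta : t < a
  · have : ENNReal.ofReal t < ENNReal.ofReal a := (ENNReal.ofReal_lt_ofReal_iff_of_nonneg ht.le).2 hta
    simp [hta, this, indicator]
  · have : ¬ ENNReal.ofReal t < ENNReal.ofReal a := by
      simpa using ENNReal.ofReal_le_ofReal (not_lt.1 hta)
    simp [hta, this, indicator]

lemma rpow_eq_lintegral {q : ℝ} (hq : 0 < q) (x : ℝ≥0∞) :
    x ^ q = ENNReal.ofReal q * ∫⁻ t in Ioi (0 : ℝ),
      {t | ENNReal.ofReal t < x}.indicator (fun t => ENNReal.ofReal (t ^ (q - 1))) t := by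
  rcases eq_or_ne x ∞ with rfl | hx
  · rw [ENNReal.top_rpow_of_pos hq]
    symm
    refine ENNReal.eq_top_of_forall_nnreal_le fun y => ?_
    have hy : ((y : ℝ≥0∞) ^ q⁻¹) ≠ ∞ := by finiteness
    calc (y : ℝ≥0∞) = ENNReal.ofReal ((y : ℝ≥0∞) ^ q⁻¹).toReal ^ q := by
          rw [ENNReal.ofReal_toReal hy, ENNReal.rpow_inv_rpow hq.ne']
      _ ≤ _ := by
          rw [ofReal_rpow_eq_lintegral hq ENNReal.toReal_nonneg]
          gcongr with t
          exact le_top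
  · rw [← ENNReal.ofReal_toReal hx]
    exact ofReal_rpow_eq_lintegral hq ENNReal.toReal_nonneg

lemma lintegral_rpow_eq_lintegral_volume_mul {q : ℝ} (hq : 0 < q) {v : Rn n → ℝ≥0∞}
    (hv : Measurable v) (μ : Measure (Rn n)) [SFinite μ] :
    ∫⁻ x, v x ^ q ∂μ = ENNReal.ofReal q * ∫⁻ t in Ioi (0 : ℝ),
      ENNReal.ofReal (t ^ (q - 1)) * μ {x | ENNReal.ofReal t < v x} := by
  simp_rw [rpow_eq_lintegral hq]
  have hmeas : Measurable (Function.uncurry fun (x : Rn n) (t : ℝ) =>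
      {t | ENNReal.ofReal t < v x}.indicator (fun t => ENNReal.ofReal (t ^ (q - 1))) t) := by
    have : MeasurableSet {z : Rn n × ℝ | ENNReal.ofReal z.2 < v z.1} :=
      measurableSet_lt (by fun_prop) (by fun_prop)
    refine (Measurable.indicator (f := fun z : Rn n × ℝ => ENNReal.ofReal (z.2 ^ (q - 1)))
      (by fun_prop) this)
  rw [lintegral_const_mul' _ _ ENNReal.ofReal_ne_top, lintegral_lintegral_swap hmeas.aemeasurable]
  congr 1
  refine lintegral_congr fun t => ?_
  rw [← lintegral_indicator_const (measurableSet_lt (by fun_prop) hv)]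
  rfl

/-- The strong type `(q, q)` inequality for the maximal function, `q > 1`. -/
lemma exists_lintegral_maximalFn_rpow_le (hn : n ≠ 0) {q : ℝ} (hq : 1 < q) :
    ∃ C : ℝ≥0, ∀ u : Rn n → ℝ≥0∞, Measurable u →
      ∫⁻ x, maximalFn u x ^ q ≤ C * ∫⁻ x, u x ^ q := by
  set κ := volume (ball (0 : Rn n) 1) with hκdef
  have hκ : κ ≠ 0 := (measure_ball_pos _ _ one_pos).ne'
  have hκ' : κ ≠ ∞ := measure_ball_lt_top.ne
  have h2κ : 2 * κ ≠ 0 := by positivity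
  have h2κ' : 2 * κ ≠ ∞ := by finiteness
  have hq0 : 0 < q := by linarith
  set C : ℝ≥0∞ := (2 * κ) ^ q * (ENNReal.ofReal q * (5 ^ n * ENNReal.ofReal (q - 1)⁻¹)) with hC
  have hC' : C ≠ ∞ := by rw [hC]; finiteness
  refine ⟨C.toNNReal, fun u hu => ?_⟩
  rw [ENNReal.coe_toNNReal hC']
  have hv : Measurable fun x => (2 * κ)⁻¹ * maximalFn u x := (measurable_maximalFn u).const_mul _
  have h1 : ∀ x, maximalFn u x ^ q = (2 * κ) ^ q * ((2 * κ)⁻¹ * maximalFn u x) ^ q := by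
    intro x
    rw [← ENNReal.mul_rpow_of_nonneg _ _ hq0.le, ← mul_assoc, ENNReal.mul_inv_cancel h2κ h2κ',
      one_mul]
  have hw : ∫⁻ t in Ioi (0 : ℝ), ENNReal.ofReal (t ^ (q - 1)) *
      volume {x | ENNReal.ofReal t < (2 * κ)⁻¹ * maximalFn u x} ≤
      5 ^ n * (ENNReal.ofReal (q - 1)⁻¹ * ∫⁻ x, u x ^ q) := by
    have h2 : ∀ t ∈ Ioi (0 : ℝ), ENNReal.ofReal (t ^ (q - 1)) *
      volume {x | ENNReal.ofReal t < (2 * κ)⁻¹ * maximalFn u x} ≤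
        5 ^ n * (ENNReal.ofReal (t ^ (q - 1 - 1)) *
          (volume.withDensity u) {x | ENNReal.ofReal t < u x}) := by
      intro t ht
      have ht : 0 < t := ht
      have h3 := volume_lt_maximalFn_le hn u (T := ENNReal.ofReal t) (by simpa using ht)
        ENNReal.ofReal_ne_top
      have hms : MeasurableSet {x | ENNReal.ofReal t < u x} := measurableSet_lt (by fun_prop) hu
      rw [lintegral_indicator hms, ← withDensity_apply _ hms] at h3
      have h4 : {x | ENNReal.ofReal t < (2 * κ)⁻¹ * maximalFn u x} =
          {x | 2 * κ * ENNReal.ofReal t < maximalFn u x} := by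
        ext x
        simp only [mem_ofPred_eq]
        rw [mul_comm _ (maximalFn u x), ← div_eq_mul_inv,
          ENNReal.lt_div_iff_mul_lt (.inl h2κ) (.inl h2κ'), mul_comm]
      rw [h4]
      refine (mul_le_mul_right h3 _).trans_eq ?_
      rw [Real.rpow_sub_one ht.ne' (q - 1), div_eq_mul_inv, ENNReal.ofReal_mul (by positivity),
        ENNReal.ofReal_inv_of_pos ht]
      ring
    refine (setLIntegral_mono' measurableSet_Ioi h2).trans ?_
    rw [lintegral_const_mul' _ _ (by finiteness)]
    gcongr
    -- The integral of u over {u > t} is the measure of that set under u dx, so the remaining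
    -- t-integral is a layer cake for u ^ (q - 1) against u dx. This is the source of the factor 1 /
    -- (q - 1).
    have h5 := lintegral_rpow_eq_lintegral_volume_mul (sub_pos.2 hq) hu (volume.withDensity u)
    have h6 : ∫⁻ x, u x ^ (q - 1) ∂(volume.withDensity u) = ∫⁻ x, u x ^ q := by
      rw [lintegral_withDensity_eq_lintegral_mul _ hu (hu.pow_const _)]
      refine lintegral_congr fun x => ?_
      simp only [Pi.mul_apply]
      nth_rewrite 1 [← ENNReal.rpow_one (u x)]
      rw [← ENNReal.rpow_add_of_nonneg _ _ zero_le_one (by linarith)]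
      congr 1; ring
    rw [← h6, h5, ← mul_assoc, ← ENNReal.ofReal_mul (by rw [inv_nonneg]; linarith),
      inv_mul_cancel₀ (by linarith), ENNReal.ofReal_one, one_mul]
  calc ∫⁻ x, maximalFn u x ^ q = (2 * κ) ^ q * ∫⁻ x, ((2 * κ)⁻¹ * maximalFn u x) ^ q := by
        simp_rw [h1]
        rw [lintegral_const_mul' _ _ (by finiteness)]
    _ ≤ (2 * κ) ^ q * (ENNReal.ofReal q *
        (5 ^ n * (ENNReal.ofReal (q - 1)⁻¹ * ∫⁻ x, u x ^ q))) := by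
        rw [lintegral_rpow_eq_lintegral_volume_mul hq0 hv volume]
        gcongr
    _ = C * ∫⁻ x, u x ^ q := by rw [hC]; ring

/-! ### Convolution with a polynomially decaying kernel. -/

/-- The kernel `δⁿ (1 + δ |z - w|)^{-(n+1)}`. -/
def polyKernel (n : ℕ) (δ : ℝ) (z w : Rn n) : ℝ≥0∞ :=
  ENNReal.ofReal (δ ^ n / (1 + δ * ‖z - w‖) ^ (n + 1))

@[fun_prop]
lemma measurable_polyKernel (δ : ℝ) (z : Rn n) : Measurable (polyKernel n δ z) := by
  unfold polyKernel; fun_prop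

/-- Only the term with 2 ^ k ≤ 1 + δ|z - w| < 2 ^ (k + 1) is needed. -/
lemma polyKernel_le_tsum {δ : ℝ} (hδ : 0 < δ) (z w : Rn n) :
    polyKernel n δ z w ≤ ∑' k : ℕ, (ball z (2 ^ (k + 1) / δ)).indicator
      (fun _ => ENNReal.ofReal (δ ^ n / 2 ^ (k * (n + 1)))) w := by
  have hs : 1 ≤ 1 + δ * ‖z - w‖ := by have : 0 ≤ δ * ‖z - w‖ := by positivity
                                      linarith
  obtain ⟨k, hk, hk'⟩ := exists_nat_pow_near hs one_lt_two
  refine le_trans ?_ (ENNReal.le_tsum k)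
  have hw : w ∈ ball z (2 ^ (k + 1) / δ) := by
    rw [mem_ball, dist_comm, dist_eq_norm, lt_div_iff₀ hδ, mul_comm]
    linarith
  rw [indicator_of_mem hw, polyKernel]
  gcongr
  rw [pow_mul]
  gcongr

/-- Convolutions with the kernel `polyKernel` are controlled by the maximal function. -/
lemma lintegral_mul_polyKernel_le {u : Rn n → ℝ≥0∞} (hu : Measurable u) {δ : ℝ} (hδ : 0 < δ)
    (x z : Rn n) :
    ∫⁻ w, u w * polyKernel n δ z w ≤
      2 ^ (n + 1) * ENNReal.ofReal ((1 + δ * ‖z - x‖) ^ n) * maximalFn u x := by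
  have hind : ∀ (k : ℕ) (w : Rn n), u w * (ball z (2 ^ (k + 1) / δ)).indicator
      (fun _ => ENNReal.ofReal (δ ^ n / 2 ^ (k * (n + 1)))) w =
      ENNReal.ofReal (δ ^ n / 2 ^ (k * (n + 1))) * (ball z (2 ^ (k + 1) / δ)).indicator u w := by
    intro k w
    by_cases hw : w ∈ ball z (2 ^ (k + 1) / δ)
    · simp only [indicator_of_mem hw]; ring
    · simp only [indicator_of_notMem hw]; simp
  have hk : ∀ k : ℕ, ENNReal.ofReal (δ ^ n / 2 ^ (k * (n + 1))) *
      ∫⁻ w in ball z (2 ^ (k + 1) / δ), u w ≤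
      (2⁻¹ : ℝ≥0∞) ^ k * (2 ^ n * ENNReal.ofReal ((1 + δ * ‖z - x‖) ^ n) * maximalFn u x) := by
    intro k
    -- Enlarging the radius by |z - x| brings x into the ball and costs (1 + δ|z - x|) ^ n; the
    -- extra power in the exponent n + 1 leaves the summable factor 2 ^ (-k).
    have hsub : ball z (2 ^ (k + 1) / δ) ⊆ ball z (‖z - x‖ + 2 ^ (k + 1) / δ) :=
      ball_subset_ball (by linarith [norm_nonneg (z - x)])
    have hx : x ∈ ball z (‖z - x‖ + 2 ^ (k + 1) / δ) := by
      rw [mem_ball, dist_comm, dist_eq_norm]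
      have : (0 : ℝ) < 2 ^ (k + 1) / δ := by positivity
      linarith
    have hpos : 0 < ‖z - x‖ + 2 ^ (k + 1) / δ := by positivity
    calc _ ≤ ENNReal.ofReal (δ ^ n / 2 ^ (k * (n + 1))) *
          (ENNReal.ofReal ((‖z - x‖ + 2 ^ (k + 1) / δ) ^ n) * maximalFn u x) := by
          gcongr
          exact (lintegral_mono_set hsub).trans (setLIntegral_ball_le_maximalFn u hpos hx)
      _ = ENNReal.ofReal (δ ^ n / 2 ^ (k * (n + 1)) * (‖z - x‖ + 2 ^ (k + 1) / δ) ^ n) *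
          maximalFn u x := by
          rw [ENNReal.ofReal_mul (by positivity), mul_assoc]
      _ ≤ ENNReal.ofReal ((2⁻¹ : ℝ) ^ k * (2 ^ n * (1 + δ * ‖z - x‖) ^ n)) * maximalFn u x := by
          refine mul_le_mul_left (ENNReal.ofReal_le_ofReal ?_) _
          have h1 : δ ^ n / 2 ^ (k * (n + 1)) * (‖z - x‖ + 2 ^ (k + 1) / δ) ^ n =
              (δ * ‖z - x‖ + 2 ^ (k + 1)) ^ n / 2 ^ (k * (n + 1)) := by
            rw [div_mul_eq_mul_div, ← mul_pow]
            congr 2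
            field_simp
          have h2 : δ * ‖z - x‖ + 2 ^ (k + 1) ≤ 2 ^ (k + 1) * (1 + δ * ‖z - x‖) := by
            have h3 : 0 ≤ δ * ‖z - x‖ := by positivity
            have h4 : (1 : ℝ) ≤ 2 ^ (k + 1) := one_le_pow₀ one_le_two
            nlinarith
          rw [h1]
          calc _ ≤ (2 ^ (k + 1) * (1 + δ * ‖z - x‖)) ^ n / 2 ^ (k * (n + 1)) := by gcongr
            _ = _ := by
              rw [mul_pow, ← pow_mul, inv_pow]
              field_simp
              ring
      _ = _ := by
          rw [ENNReal.ofReal_mul (by positivity), ENNReal.ofReal_mul (by positivity),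
            ENNReal.ofReal_pow (by norm_num), ENNReal.ofReal_pow (by norm_num),
            ENNReal.ofReal_inv_of_pos (by norm_num)]
          norm_num
          ring
  calc ∫⁻ w, u w * polyKernel n δ z w
      ≤ ∫⁻ w, ∑' k : ℕ, ENNReal.ofReal (δ ^ n / 2 ^ (k * (n + 1))) *
          (ball z (2 ^ (k + 1) / δ)).indicator u w := by
        simp_rw [← hind, ENNReal.tsum_mul_left]
        gcongr with w
        exact polyKernel_le_tsum hδ z w
    _ = ∑' k : ℕ, ENNReal.ofReal (δ ^ n / 2 ^ (k * (n + 1))) *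
          ∫⁻ w in ball z (2 ^ (k + 1) / δ), u w := by
        rw [lintegral_tsum fun k => ((hu.indicator measurableSet_ball).const_mul _).aemeasurable]
        refine tsum_congr fun k => ?_
        rw [lintegral_const_mul' _ _ ENNReal.ofReal_ne_top, lintegral_indicator measurableSet_ball]
    _ ≤ ∑' k : ℕ, (2⁻¹ : ℝ≥0∞) ^ k *
          (2 ^ n * ENNReal.ofReal ((1 + δ * ‖z - x‖) ^ n) * maximalFn u x) :=
        ENNReal.tsum_le_tsum hk
    _ = _ := by
        rw [ENNReal.tsum_mul_right, ENNReal.tsum_geometric, ENNReal.one_sub_inv_two, inv_inv]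
        ring

lemma maximalFn_one_le (x : Rn n) :
    maximalFn (fun _ => 1) x ≤ volume (ball (0 : Rn n) 1) := by
  refine maximalFn_le fun c ρ hρ _ => ?_
  rw [setLIntegral_const, one_mul, volume_ball_eq _ hρ, ← mul_assoc,
    ENNReal.inv_mul_cancel (by simpa using by positivity) ENNReal.ofReal_ne_top, one_mul]

lemma lintegral_polyKernel_le {δ : ℝ} (hδ : 0 < δ) (z : Rn n) :
    ∫⁻ w, polyKernel n δ z w ≤ 2 ^ (n + 1) * volume (ball (0 : Rn n) 1) := by
  have h := lintegral_mul_polyKernel_le (u := fun _ => 1) measurable_const hδ z z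
  simp only [one_mul, sub_self, norm_zero, mul_zero, add_zero, one_pow, ENNReal.ofReal_one,
    mul_one] at h
  exact h.trans (mul_le_mul_right (maximalFn_one_le z) _)

/-- Hölder's inequality against the constant 1. It serves both for the measure with density
`polyKernel` and for Lebesgue measure on a cube. -/
lemma lintegral_rpow_le_measure_univ_mul {α : Type*} [MeasurableSpace α] (μ : Measure α)
    {q : ℝ} (hq : 1 ≤ q) {u : α → ℝ≥0∞} (hu : Measurable u) :
    (∫⁻ x, u x ∂μ) ^ q ≤ μ univ ^ (q - 1) * ∫⁻ x, u x ^ q ∂μ := by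
  have hq0 : 0 < q := by linarith
  have h := eLpNorm'_le_eLpNorm'_mul_rpow_measure_univ (μ := μ) one_pos hq hu.aestronglyMeasurable
  simp only [eLpNorm', enorm_eq_self, ENNReal.rpow_one, div_one] at h
  calc _ ≤ ((∫⁻ x, u x ^ q ∂μ) ^ (1 / q) * μ univ ^ (1 - 1 / q)) ^ q := by gcongr
    _ = _ := by
      rw [ENNReal.mul_rpow_of_nonneg _ _ hq0.le, ← ENNReal.rpow_mul, ← ENNReal.rpow_mul, mul_comm]
      congr 2
      · field_simp
      · rw [one_div_mul_cancel hq0.ne', ENNReal.rpow_one]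

/-! ### From a reproducing estimate for g to one for its r-th power. -/

/-- The quantity `1 + δ |z - w|` in `[0, ∞]`. -/
def weight (δ : ℝ) (z w : Rn n) : ℝ≥0∞ := ENNReal.ofReal (1 + δ * ‖z - w‖)

lemma one_le_weight {δ : ℝ} (hδ : 0 < δ) (z w : Rn n) : 1 ≤ weight δ z w := by
  rw [weight, ENNReal.one_le_ofReal]
  have : 0 ≤ δ * ‖z - w‖ := by positivity
  linarith

lemma weight_ne_zero {δ : ℝ} (hδ : 0 < δ) (z w : Rn n) : weight δ z w ≠ 0 :=
  (zero_lt_one.trans_le (one_le_weight hδ z w)).ne'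

lemma weight_ne_top (δ : ℝ) (z w : Rn n) : weight δ z w ≠ ∞ := ENNReal.ofReal_ne_top

lemma weight_le_mul {δ : ℝ} (hδ : 0 < δ) (z v w : Rn n) :
    weight δ z w ≤ weight δ z v * weight δ v w := by
  rw [weight, weight, weight, ← ENNReal.ofReal_mul (by positivity)]
  refine ENNReal.ofReal_le_ofReal ?_
  have h1 : ‖z - w‖ ≤ ‖z - v‖ + ‖v - w‖ := norm_sub_le_norm_sub_add_norm_sub _ _ _
  have h2 : δ * ‖z - w‖ ≤ δ * (‖z - v‖ + ‖v - w‖) := by gcongr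
  have h3 : 0 ≤ (δ * ‖z - v‖) * (δ * ‖v - w‖) := by positivity
  nlinarith

lemma polyKernel_eq {δ : ℝ} (hδ : 0 < δ) (z w : Rn n) :
    polyKernel n δ z w = ENNReal.ofReal (δ ^ n) * weight δ z w ^ (-((n : ℝ) + 1)) := by
  have h : 0 < 1 + δ * ‖z - w‖ := by positivity
  rw [polyKernel, weight, ENNReal.ofReal_rpow_of_pos h, ← ENNReal.ofReal_mul (by positivity),
    Real.rpow_neg h.le, div_eq_mul_inv]
  norm_cast

lemma weight_rpow_le_rpow {δ : ℝ} (hδ : 0 < δ) (z w : Rn n) {a b : ℝ} (h : a ≤ b) :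
    weight δ z w ^ a ≤ weight δ z w ^ b :=
  ENNReal.rpow_le_rpow_of_exponent_le (one_le_weight hδ z w) h

/-- The subharmonicity-type estimate for small exponents: a bounded function dominated by its own
convolution with a decaying kernel satisfies the same estimate for its `r`-th power, `r ≤ 1`. -/
lemma rpow_le_lintegral_of_le_one {r N δ : ℝ} (hr : 0 < r) (hr1 : r ≤ 1)
    (hNr : (n : ℝ) + 1 ≤ N * r) (hδ : 0 < δ) {C B : ℝ≥0∞} (hB : B ≠ ∞)
    {g : Rn n → ℝ≥0∞} (hgB : ∀ z, g z ≤ B)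
    (hg : ∀ v, g v ≤ C * ∫⁻ w, g w * (ENNReal.ofReal (δ ^ n) * weight δ v w ^ (-N))) (z : Rn n) :
    g z ^ r ≤ C * ∫⁻ w, g w ^ r * polyKernel n δ z w := by
  have hN : 0 ≤ N := by
    by_contra! h
    have : (0 : ℝ) ≤ n := n.cast_nonneg
    nlinarith
  -- Peetre's weighted supremum, finite because g is bounded. Writing g = g ^ r * g ^ (1 - r) and
  -- bounding the second factor by `S` gives S ≤ C S ^ (1 - r) ∫ g ^ r K, and S ^ (1 - r) is divided
  -- out at the end.
  set S := ⨆ w, g w * weight δ z w ^ (-N) with hS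
  have hgS : ∀ w, g w ≤ S * weight δ z w ^ N := by
    intro w
    have h1 : g w * weight δ z w ^ (-N) ≤ S := le_iSup (fun w => g w * weight δ z w ^ (-N)) w
    calc g w = g w * weight δ z w ^ (-N) * weight δ z w ^ N := by
          rw [mul_assoc, ← ENNReal.rpow_add _ _ (weight_ne_zero hδ z w) (weight_ne_top _ _ _)]
          simp
      _ ≤ _ := by gcongr
  have hSB : S ≤ B := by
    refine iSup_le fun w => ?_
    calc _ ≤ B * weight δ z w ^ (0 : ℝ) :=
          mul_le_mul' (hgB w) (weight_rpow_le_rpow hδ z w (by linarith))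
      _ = B := by simp
  have hSt : S ≠ ∞ := (hSB.trans_lt hB.lt_top).ne
  have hpt : ∀ v w, g w * (ENNReal.ofReal (δ ^ n) * weight δ v w ^ (-N)) * weight δ z v ^ (-N) ≤
      S ^ (1 - r) * (g w ^ r * polyKernel n δ z w) := by
    intro v w
    -- Submultiplicativity of the weight moves the decay from v to z, making the bound uniform in v.
    have h1 : weight δ v w ^ (-N) * weight δ z v ^ (-N) ≤ weight δ z w ^ (-N) := by
      rw [← ENNReal.mul_rpow_of_ne_top (weight_ne_top _ _ _) (weight_ne_top _ _ _),
        ENNReal.rpow_neg, ENNReal.rpow_neg, mul_comm]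
      gcongr
      exact weight_le_mul hδ z v w
    have h2 : g w ≤ g w ^ r * (S ^ (1 - r) * weight δ z w ^ (N * (1 - r))) := by
      calc g w = g w ^ r * g w ^ (1 - r) := by
            rw [← ENNReal.rpow_add_of_nonneg _ _ hr.le (by linarith)]; simp
        _ ≤ g w ^ r * (S * weight δ z w ^ N) ^ (1 - r) := by
            exact mul_le_mul_right (ENNReal.rpow_le_rpow (hgS w) (by linarith)) _
        _ = _ := by rw [ENNReal.mul_rpow_of_nonneg _ _ (by linarith), ENNReal.rpow_mul]
    calc _ = g w * (ENNReal.ofReal (δ ^ n) * (weight δ v w ^ (-N) * weight δ z v ^ (-N))) := by ring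
      _ ≤ (g w ^ r * (S ^ (1 - r) * weight δ z w ^ (N * (1 - r)))) *
          (ENNReal.ofReal (δ ^ n) * weight δ z w ^ (-N)) := by gcongr
      _ = S ^ (1 - r) * (g w ^ r * (ENNReal.ofReal (δ ^ n) *
          (weight δ z w ^ (N * (1 - r)) * weight δ z w ^ (-N)))) := by ring
      _ ≤ _ := by
          rw [← ENNReal.rpow_add _ _ (weight_ne_zero hδ z w) (weight_ne_top _ _ _),
            polyKernel_eq hδ]
          gcongr
          · exact one_le_weight hδ z w
          · linarith
  have hSle : S ≤ C * (S ^ (1 - r) * ∫⁻ w, g w ^ r * polyKernel n δ z w) := by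
    refine iSup_le fun v => ?_
    have hwt : weight δ z v ^ (-N) ≠ ∞ :=
      ENNReal.rpow_ne_top_of_ne_zero (weight_ne_zero hδ z v) (weight_ne_top _ _ _)
    have hSr : S ^ (1 - r) ≠ ∞ := ENNReal.rpow_ne_top_of_nonneg (by linarith) hSt
    calc _ ≤ C * (∫⁻ w, g w * (ENNReal.ofReal (δ ^ n) * weight δ v w ^ (-N))) *
            weight δ z v ^ (-N) := by gcongr; exact hg v
      _ = C * ∫⁻ w, g w * (ENNReal.ofReal (δ ^ n) * weight δ v w ^ (-N)) *
            weight δ z v ^ (-N) := by rw [lintegral_mul_const' _ _ hwt, mul_assoc]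
      _ ≤ C * ∫⁻ w, S ^ (1 - r) * (g w ^ r * polyKernel n δ z w) := by
          exact mul_le_mul_right (lintegral_mono fun w => hpt v w) _
      _ = _ := by rw [lintegral_const_mul' _ _ hSr]
  have hgz : g z ≤ S := by simpa [weight] using hgS z
  refine (ENNReal.rpow_le_rpow hgz hr.le).trans ?_
  rcases eq_or_ne S 0 with h0 | h0
  · rw [h0, ENNReal.zero_rpow_of_pos hr]; exact zero_le
  calc S ^ r = S * S ^ (-(1 - r)) := by
        nth_rewrite 2 [← ENNReal.rpow_one S]
        rw [← ENNReal.rpow_add _ _ h0 hSt]; congr 1; ring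
    _ ≤ C * (S ^ (1 - r) * ∫⁻ w, g w ^ r * polyKernel n δ z w) * S ^ (-(1 - r)) := by gcongr
    _ = C * (∫⁻ w, g w ^ r * polyKernel n δ z w) * (S ^ (1 - r) * S ^ (-(1 - r))) := by ring
    _ = _ := by rw [← ENNReal.rpow_add _ _ h0 hSt]; simp

/-- Jensen's inequality for the measure with density `polyKernel`, whose mass is bounded
independently of δ. -/
lemma rpow_le_lintegral_of_one_le {r N δ : ℝ} (hr : 1 ≤ r)
    (hN : (n : ℝ) + 1 ≤ N) (hδ : 0 < δ) {C : ℝ≥0∞}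
    {g : Rn n → ℝ≥0∞} (hgm : Measurable g)
    (hg : ∀ v, g v ≤ C * ∫⁻ w, g w * (ENNReal.ofReal (δ ^ n) * weight δ v w ^ (-N))) (z : Rn n) :
    g z ^ r ≤ C ^ r * (2 ^ (n + 1) * volume (ball (0 : Rn n) 1)) ^ (r - 1) *
      ∫⁻ w, g w ^ r * polyKernel n δ z w := by
  have hr0 : 0 < r := by linarith
  have h1 : g z ≤ C * ∫⁻ w, g w * polyKernel n δ z w := by
    refine (hg z).trans ?_
    gcongr with w
    rw [polyKernel_eq hδ]
    gcongr
    exact one_le_weight hδ z w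
  have hd : ∀ v : Rn n → ℝ≥0∞, Measurable v →
      ∫⁻ w, v w * polyKernel n δ z w = ∫⁻ w, v w ∂(volume.withDensity (polyKernel n δ z)) := by
    intro v hv
    rw [lintegral_withDensity_eq_lintegral_mul _ (measurable_polyKernel δ z) hv]
    simp_rw [Pi.mul_apply, mul_comm]
  rw [hd _ hgm] at h1
  rw [hd _ (hgm.pow_const r)]
  calc g z ^ r ≤ (C * ∫⁻ w, g w ∂(volume.withDensity (polyKernel n δ z))) ^ r := by gcongr
    _ ≤ C ^ r * ((volume.withDensity (polyKernel n δ z)) univ ^ (r - 1) *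
        ∫⁻ w, g w ^ r ∂(volume.withDensity (polyKernel n δ z))) := by
        rw [ENNReal.mul_rpow_of_nonneg _ _ hr0.le]
        gcongr
        exact lintegral_rpow_le_measure_univ_mul _ hr hgm
    _ ≤ _ := by
        rw [← mul_assoc]
        refine mul_le_mul_left (mul_le_mul_right (ENNReal.rpow_le_rpow ?_ (by linarith)) _) _
        rw [withDensity_apply _ MeasurableSet.univ, Measure.restrict_univ]
        exact lintegral_polyKernel_le hδ z

/-- The Peetre inequality for bounded functions that are dominated by their convolution with a
rapidly decreasing kernel at scale `δ⁻¹`; the constant does not depend on `δ`. -/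
lemma exists_rpow_le_maximalFn (n : ℕ) {r N : ℝ} (hr : 0 < r) (hN : (n : ℝ) + 1 ≤ N)
    (hNr : (n : ℝ) + 1 ≤ N * r) (C : ℝ≥0) :
    ∃ C' : ℝ≥0, ∀ δ : ℝ, 0 < δ → ∀ (B : ℝ≥0) (g : Rn n → ℝ≥0∞), Measurable g →
      (∀ z, g z ≤ B) →
      (∀ v, g v ≤ C * ∫⁻ w, g w * (ENNReal.ofReal (δ ^ n) * weight δ v w ^ (-N))) →
      ∀ x z, g z ^ r ≤ C' * ENNReal.ofReal ((1 + δ * ‖z - x‖) ^ n) *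
        maximalFn (fun w => g w ^ r) x := by
  obtain ⟨C₁, hC₁⟩ : ∃ C₁ : ℝ≥0, ∀ δ : ℝ, 0 < δ → ∀ (B : ℝ≥0) (g : Rn n → ℝ≥0∞), Measurable g →
      (∀ z, g z ≤ B) →
      (∀ v, g v ≤ C * ∫⁻ w, g w * (ENNReal.ofReal (δ ^ n) * weight δ v w ^ (-N))) →
      ∀ z, g z ^ r ≤ C₁ * ∫⁻ w, g w ^ r * polyKernel n δ z w := by
    rcases le_total r 1 with h | h
    · exact ⟨C, fun δ hδ B g _ hgB hg z => rpow_le_lintegral_of_le_one hr h hNr hδ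
        ENNReal.coe_ne_top hgB hg z⟩
    · refine ⟨((C : ℝ≥0∞) ^ r *
        (2 ^ (n + 1) * volume (ball (0 : Rn n) 1)) ^ (r - 1)).toNNReal,
        fun δ hδ B g hgm _ hg z => ?_⟩
      have hκ' : volume (ball (0 : Rn n) 1) ≠ ∞ := measure_ball_lt_top.ne
      rw [ENNReal.coe_toNNReal]
      · exact rpow_le_lintegral_of_one_le h hN hδ hgm hg z
      · refine ENNReal.mul_ne_top (by finiteness) (ENNReal.rpow_ne_top_of_nonneg (by linarith) ?_)
        finiteness
  refine ⟨C₁ * 2 ^ (n + 1), fun δ hδ B g hgm hgB hg x z => ?_⟩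
  refine (hC₁ δ hδ B g hgm hgB hg z).trans ?_
  refine (mul_le_mul_right (lintegral_mul_polyKernel_le (hgm.pow_const r) hδ x z) _).trans_eq ?_
  push_cast
  ring

/-! ### Spectral support and the reproducing formula. -/

/-- A tempered distribution vanishes on compactly supported test functions whose support is
disjoint from the support of the distribution. -/
lemma apply_eq_zero_of_disjoint_dsupport (T : 𝓢'(Rn n, ℂ)) (u : 𝓢(Rn n, ℂ))
    (hc : HasCompactSupport u) (hd : Disjoint (tsupport u) (Distribution.dsupport T)) :
    T u = 0 := by
  have hloc : ∀ x : tsupport u, ∃ s : Set (Rn n), Distribution.IsVanishingOn T s ∧ IsOpen s ∧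
      (x : Rn n) ∈ s := fun x =>
    (Distribution.notMem_dsupport_iff _).1 (Set.disjoint_left.1 hd x.2)
  choose U hU hUo hUx using hloc
  -- `IsVanishingOn` is only known locally; a partition of unity splits u into finitely many pieces,
  -- each supported in one vanishing set.
  obtain ⟨ρ, hρ⟩ := SmoothPartitionOfUnity.exists_isSubordinate (modelWithCornersSelf ℝ (Rn n))
    (isClosed_tsupport u) U hUo fun x hx => mem_iUnion.2 ⟨⟨x, hx⟩, hUx ⟨x, hx⟩⟩
  have hfin : {i | (Function.support (ρ i) ∩ tsupport u).Nonempty}.Finite :=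
    ρ.locallyFinite.finite_nonempty_inter_compact hc
  have hsm : ∀ i, ContDiff ℝ ((⊤ : ℕ∞) : WithTop ℕ∞) fun x => ((ρ i x : ℝ) : ℂ) * u x := fun i =>
    (Complex.ofRealCLM.contDiff.comp (ρ i).contMDiff.contDiff).mul u.smooth'
  have hcs : ∀ i, HasCompactSupport fun x => ((ρ i x : ℝ) : ℂ) * u x := fun i =>
    HasCompactSupport.mul_left hc
  have hsum : u = ∑ i ∈ hfin.toFinset, (hcs i).toSchwartzMap (hsm i) := by
    ext x
    rw [sum_apply]
    change u x = ∑ i ∈ hfin.toFinset, ((ρ i x : ℝ) : ℂ) * u x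
    by_cases hx : x ∈ tsupport u
    · have h1 := ρ.sum_eq_one hx
      rw [finsum_eq_sum_of_support_subset _ (s := hfin.toFinset)] at h1
      · rw [← Finset.sum_mul, ← Complex.ofReal_sum, h1]; simp
      · intro i hi
        simpa using ⟨x, hi, hx⟩
    · simp [image_eq_zero_of_notMem_tsupport hx]
  rw [hsum, map_sum]
  refine Finset.sum_eq_zero fun i _ => hU i _ ?_
  exact (tsupport_mul_subset_left (f := fun x => ((ρ i x : ℝ) : ℂ))).trans
    ((tsupport_comp_subset (g := ((↑) : ℝ → ℂ)) Complex.ofReal_zero _).trans (hρ i))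

/-- Multiplication of a band-limited function by the Fourier transform of a bump function `b`
yields an integrable function whose spectrum lies in `Ω + supp b`. -/
lemma fourier_mul_eq_zero {T : 𝓢'(Rn n, ℂ)} {f : Rn n → ℂ} (hT : IsGivenBy T f) {Ω : Set (Rn n)}
    (hΩ : Distribution.dsupport (𝓕 T : 𝓢'(Rn n, ℂ)) ⊆ Ω) {b : 𝓢(Rn n, ℂ)} {η : ℝ}
    (hb : tsupport b ⊆ closedBall 0 η) {ξ : Rn n} (hξ : Disjoint (closedBall ξ η) Ω) :
    𝓕 (fun x => (𝓕 b) x * f x) ξ = 0 := by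
  have hbc : HasCompactSupport b :=
    HasCompactSupport.of_support_subset_isCompact (isCompact_closedBall 0 η)
      ((subset_tsupport _).trans hb)
  have hvc : HasCompactSupport fun y => b (y + -ξ) :=
    hbc.comp_homeomorph (Homeomorph.addRight (-ξ))
  have hvs : ContDiff ℝ ((⊤ : ℕ∞) : WithTop ℕ∞) fun y => b (y + -ξ)  :=
    b.smooth'.comp (contDiff_id.add contDiff_const)
  set v : 𝓢(Rn n, ℂ) := hvc.toSchwartzMap hvs with hv
  have h1 : ∀ x, (𝓕 v) x = Real.fourierChar (-inner ℝ x ξ) • (𝓕 b) x := by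
    intro x
    have := congrFun (VectorFourier.fourierIntegral_comp_add_right Real.fourierChar
      (volume : Measure (Rn n)) (innerₗ (Rn n)) (b : Rn n → ℂ) (-ξ)) x
    rw [SchwartzMap.fourier_coe, SchwartzMap.fourier_coe]
    refine this.trans ?_
    simp [real_inner_comm]
    rfl
  -- The transform at ξ is 𝓕 T tested on the translate b(· - ξ), whose support lies in the ball of
  -- radius η about ξ.
  have h2 : 𝓕 (fun x => (𝓕 b) x * f x) ξ = (𝓕 T : 𝓢'(Rn n, ℂ)) v := by
    rw [TemperedDistribution.fourier_apply, (hT (𝓕 v)).2, Real.fourier_eq]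
    refine integral_congr_ae (Filter.Eventually.of_forall fun x => ?_)
    simp only [h1, smul_mul_assoc]
  rw [h2]
  refine apply_eq_zero_of_disjoint_dsupport _ v hvc ?_
  refine Set.disjoint_of_subset ?_ hΩ hξ
  refine closure_minimal ?_ isClosed_closedBall
  intro y hy
  have : y + -ξ ∈ closedBall (0 : Rn n) η := hb (subset_tsupport _ hy)
  simpa [dist_eq_norm, sub_eq_add_neg] using this

lemma exists_norm_le_one_add_norm_pow (θ : 𝓢(Rn n, ℂ)) (L : ℕ) :
    ∃ C : ℝ, 0 ≤ C ∧ ∀ x, ‖θ x‖ ≤ C / (1 + ‖x‖) ^ L := by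
  set C := 2 ^ L * ((Finset.Iic (L, 0)).sup fun m => SchwartzMap.seminorm ℝ m.1 m.2) θ with hC
  have h : ∀ x, (1 + ‖x‖) ^ L * ‖θ x‖ ≤ C := fun x => by
    simpa using SchwartzMap.one_add_le_sup_seminorm_apply (𝕜 := ℝ) (m := (L, 0)) le_rfl le_rfl θ x
  refine ⟨C, (by positivity : (0 : ℝ) ≤ (1 + ‖(0 : Rn n)‖) ^ L * ‖θ 0‖).trans (h 0), fun x => ?_⟩
  rw [le_div_iff₀ (by positivity), mul_comm]
  exact h x

/-- Dilations and translations of a test function on the Fourier side. -/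
lemma fourier_comp_dilation (χ : Rn n → ℂ) {δ : ℝ} (hδ : 0 < δ) (ξ₀ z w : Rn n) :
    ‖𝓕 (fun ξ => χ (δ⁻¹ • (ξ - ξ₀)) * (Real.fourierChar (inner ℝ ξ z) : ℂ)) w‖ =
      δ ^ n * ‖𝓕⁻ χ (δ • (z - w))‖ := by
  set G : Rn n → ℂ := fun ζ => χ ζ * (Real.fourierChar (inner ℝ ξ₀ (z - w)) : ℂ) *
    (Real.fourierChar (inner ℝ ζ (δ • (z - w))) : ℂ) with hG
  have h1 : 𝓕 (fun ξ => χ (δ⁻¹ • (ξ - ξ₀)) * (Real.fourierChar (inner ℝ ξ z) : ℂ)) w =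
      ∫ ξ, G (δ⁻¹ • (ξ - ξ₀)) := by
    rw [Real.fourier_eq]
    refine integral_congr_ae (Filter.Eventually.of_forall fun ξ => ?_)
    simp only [hG, Circle.smul_def, smul_eq_mul]
    have h2 : -inner ℝ ξ w + inner ℝ ξ z =
        inner ℝ ξ₀ (z - w) + inner ℝ (δ⁻¹ • (ξ - ξ₀)) (δ • (z - w)) := by
      rw [real_inner_smul_left, real_inner_smul_right, ← mul_assoc, inv_mul_cancel₀ hδ.ne', one_mul,
        inner_sub_left, inner_sub_right, inner_sub_right]
      ring
    have h3 := congrArg (fun t => (Real.fourierChar t : ℂ)) h2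
    simp only [AddChar.map_add_eq_mul, Circle.coe_mul] at h3
    linear_combination χ (δ⁻¹ • (ξ - ξ₀)) * h3
  rw [h1, integral_sub_right_eq_self (fun ξ => G (δ⁻¹ • ξ)),
    Measure.integral_comp_inv_smul]
  have h4 : ∫ ζ, G ζ = (Real.fourierChar (inner ℝ ξ₀ (z - w)) : ℂ) * 𝓕⁻ χ (δ • (z - w)) := by
    rw [Real.fourierInv_eq, ← integral_const_mul]
    refine integral_congr_ae (Filter.Eventually.of_forall fun ζ => ?_)
    simp only [hG, Circle.smul_def, smul_eq_mul]
    ring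
  rw [h4, norm_smul, norm_mul, Circle.norm_coe, one_mul]
  simp [abs_of_pos hδ]

lemma exists_schwartzMap_eq_ofReal {g : Rn n → ℝ} (hc : HasCompactSupport g)
    (hs : ContDiff ℝ ((⊤ : ℕ∞) : WithTop ℕ∞) g) : ∃ χ : 𝓢(Rn n, ℂ), ∀ x, χ x = g x :=
  ⟨(hc.comp_left Complex.ofReal_zero : HasCompactSupport (Complex.ofReal ∘ g)).toSchwartzMap
    (Complex.ofRealCLM.contDiff.comp hs), fun _ => rfl⟩

/-- A continuous integrable function with spectrum in a ball of radius `2δ` is bounded, and is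
dominated by its convolution with a rapidly decreasing kernel at scale `δ⁻¹`. -/
lemma exists_enorm_le_lintegral_weight (n L : ℕ) :
    ∃ C : ℝ≥0, ∀ (δ : ℝ), 0 < δ → ∀ (ξ₀ : Rn n) (F : Rn n → ℂ), Continuous F → Integrable F →
      (∀ ξ, 2 * δ < dist ξ ξ₀ → 𝓕 F ξ = 0) →
      (∃ B : ℝ≥0, ∀ z, ‖F z‖ₑ ≤ B) ∧
      ∀ z, ‖F z‖ₑ ≤ C * ∫⁻ w, ‖F w‖ₑ * (ENNReal.ofReal (δ ^ n) * weight δ z w ^ (-(L : ℝ))) := by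
  -- Inner radius 2 makes the rescaled bump equal to 1 on the ball of radius 2δ carrying the
  -- spectrum; the outer radius 3 is immaterial.
  obtain ⟨β, hβ⟩ : ∃ β : ContDiffBump (0 : Rn n), β.rIn = 2 :=
    ⟨⟨2, 3, by norm_num, by norm_num⟩, rfl⟩
  obtain ⟨χ, hχβ⟩ := exists_schwartzMap_eq_ofReal β.hasCompactSupport β.contDiff
  obtain ⟨C, hC0, hC⟩ := exists_norm_le_one_add_norm_pow (𝓕⁻ χ) L
  refine ⟨C.toNNReal, fun δ hδ ξ₀ F hFc hFi hF => ?_⟩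
  have hcont : Continuous (𝓕 F) := by
    exact VectorFourier.fourierIntegral_continuous Real.continuous_fourierChar
      (by exact continuous_inner) hFi
  have hFhat : Integrable (𝓕 F) := by
    refine hcont.integrable_of_hasCompactSupport ?_
    refine HasCompactSupport.of_support_subset_isCompact (isCompact_closedBall ξ₀ (2 * δ)) ?_
    intro ξ hξ
    by_contra h
    exact hξ (hF ξ (by simpa using h))
  have hinv : ∀ z, F z = 𝓕⁻ (𝓕 F) z := fun z => by
    rw [hFc.fourierInv_fourier_eq hFi hFhat]
  refine ⟨⟨(∫ ξ, ‖𝓕 F ξ‖).toNNReal, fun z => ?_⟩, fun z => ?_⟩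
  · rw [← ofReal_norm]
    refine ENNReal.ofReal_le_ofReal ?_
    rw [hinv z, Real.fourierInv_eq]
    refine (norm_integral_le_integral_norm _).trans_eq ?_
    simp
  · set m : Rn n → ℂ := fun ξ => χ (δ⁻¹ • (ξ - ξ₀)) * (Real.fourierChar (inner ℝ ξ z) : ℂ) with hm
    have hmi : Integrable m := by
      have h1 : Integrable fun ξ => χ (δ⁻¹ • (ξ - ξ₀)) :=
        ((integrable_comp_smul_iff volume (χ : Rn n → ℂ) (inv_ne_zero hδ.ne')).2
          χ.integrable).comp_sub_right ξ₀
      refine h1.mul_bdd (c := 1) ?_ (Filter.Eventually.of_forall fun ξ => (Circle.norm_coe _).le)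
      exact Continuous.aestronglyMeasurable (by fun_prop)
    -- Inserting the multiplier changes nothing on the spectrum; the identity ∫ 𝓕 F · m = ∫ F · 𝓕 m
    -- then gives the convolution formula.
    have hrep : F z = ∫ w, F w * 𝓕 m w := by
      have h1 := VectorFourier.integral_fourierIntegral_smul_eq_flip
        (L := innerₗ (Rn n)) Real.continuous_fourierChar (by exact continuous_inner) hFi hmi
      rw [flip_innerₗ] at h1
      refine Eq.trans ?_ h1
      rw [hinv z, Real.fourierInv_eq]
      refine integral_congr_ae (Filter.Eventually.of_forall fun ξ => ?_)
      change _ = 𝓕 F ξ • m ξ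
      simp only [Circle.smul_def, smul_eq_mul, hm]
      by_cases hξ : dist ξ ξ₀ ≤ 2 * δ
      · have h2 : χ (δ⁻¹ • (ξ - ξ₀)) = 1 := by
          rw [hχβ, β.one_of_mem_closedBall, Complex.ofReal_one]
          rw [hβ, mem_closedBall_zero_iff, norm_smul, ← dist_eq_norm, norm_inv, Real.norm_of_nonneg hδ.le,
            inv_mul_le_iff₀ hδ, mul_comm]
          exact hξ
        rw [h2]; ring
      · rw [hF ξ (not_le.1 hξ)]; simp
    rw [hrep]
    refine (enorm_integral_le_lintegral_enorm _).trans ?_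
    rw [← lintegral_const_mul' _ _ ENNReal.coe_ne_top]
    gcongr with w
    rw [enorm_mul, mul_left_comm]
    gcongr
    rw [← ofReal_norm, hm, fourier_comp_dilation _ hδ]
    have hw : 0 < 1 + δ * ‖z - w‖ := by positivity
    rw [weight, ENNReal.ofReal_rpow_of_pos hw, ← ENNReal.ofReal_mul (by positivity)]
    change _ ≤ ENNReal.ofReal C * _
    rw [← ENNReal.ofReal_mul hC0]
    refine ENNReal.ofReal_le_ofReal ?_
    have h3 := hC (δ • (z - w))
    rw [SchwartzMap.fourierInv_coe, norm_smul, Real.norm_of_nonneg hδ.le] at h3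
    rw [Real.rpow_neg hw.le, Real.rpow_natCast]
    calc _ ≤ δ ^ n * (C / (1 + δ * ‖z - w‖) ^ L) := by gcongr
      _ = _ := by ring

/-- The Peetre inequality for band-limited functions, with the constant independent of the size of
the spectrum. -/
lemma IsBandLimited.exists_rpow_le_maximalFn (n : ℕ) {r : ℝ} (hr : 0 < r) :
    ∃ C : ℝ≥0, ∀ δ : ℝ, 0 < δ → ∀ (ξ₀ : Rn n) (Ω : Set (Rn n)), Ω ⊆ closedBall ξ₀ δ →
      ∀ f : Rn n → ℂ, IsBandLimited Ω f →
      ∀ x z, ‖f z‖ₑ ^ r ≤ C * ENNReal.ofReal ((1 + δ * ‖z - x‖) ^ n) *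
        maximalFn (fun w => ‖f w‖ₑ ^ r) x := by
  -- Decay is needed both at power L (for r ≥ 1) and at power L r (for r ≤ 1).
  obtain ⟨L, hL⟩ := exists_nat_ge (max ((n : ℝ) + 1) (((n : ℝ) + 1) / r))
  have hL1 : (n : ℝ) + 1 ≤ L := (le_max_left _ _).trans hL
  have hL2 : (n : ℝ) + 1 ≤ L * r := (div_le_iff₀ hr).1 ((le_max_right _ _).trans hL)
  obtain ⟨C₀, hC₀⟩ := exists_enorm_le_lintegral_weight n L
  obtain ⟨C, hC⟩ := GenMorrey.exists_rpow_le_maximalFn n hr hL1 hL2 C₀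
  refine ⟨C, fun δ hδ ξ₀ Ω hΩ f ⟨hfc, T, hT, hsupp⟩ x z => ?_⟩
  -- Shrinking bumps of radius at most δ keep the spectrum of `F k` within 2δ. The sup bound on `F
  -- k` may depend on k, but the final constant does not.
  have hφ : ∀ k : ℕ, ∃ φ : ContDiffBump (0 : Rn n), φ.rOut = δ / (k + 1) := fun k =>
    ⟨⟨δ / (k + 1) / 2, δ / (k + 1), by positivity, half_lt_self (by positivity)⟩, rfl⟩
  choose φ hφ using hφ
  choose b hbφ using fun k => exists_schwartzMap_eq_ofReal
    ((φ k).hasCompactSupport_normed (μ := volume)) (φ k).contDiff_normed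
  have hbs : ∀ k, tsupport (b k) ⊆ closedBall 0 (δ / (k + 1)) := fun k => by
    refine closure_minimal (fun y hy => ?_) isClosed_closedBall
    have hy' : y ∈ Function.support ((φ k).normed volume) := by
      intro h
      exact hy (by rw [hbφ, h, Complex.ofReal_zero])
    rw [(φ k).support_normed_eq, hφ] at hy'
    exact ball_subset_closedBall hy'
  have hb1 : ∀ k x, ‖(𝓕 (b k)) x‖ ≤ 1 := fun k x => by
    rw [SchwartzMap.fourier_coe, Real.fourier_eq]
    refine (norm_integral_le_integral_norm _).trans ?_
    rw [← (φ k).integral_normed (μ := volume)]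
    refine le_of_eq (integral_congr_ae (Filter.Eventually.of_forall fun y => ?_))
    simp only [Circle.norm_smul, hbφ]
    rw [Complex.norm_real, Real.norm_of_nonneg ((φ k).nonneg_normed y)]
  have hlim : ∀ x, Filter.Tendsto (fun k => (𝓕 (b k)) x) Filter.atTop (nhds 1) := fun x => by
    have h0 : Filter.Tendsto (fun k => (φ k).rOut) Filter.atTop (nhds 0) := by
      have := (tendsto_one_div_add_atTop_nhds_zero_nat (𝕜 := ℝ)).const_mul δ
      simpa [hφ, div_eq_mul_inv] using this
    -- Convolving `b k` with the character of frequency x and evaluating at 0 gives 𝓕 (b k) x, so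
    -- the limit is the character's value at 0.
    have h1 := ContDiffBump.convolution_tendsto_right_of_continuous (μ := volume) h0
      (g := fun y : Rn n => (Real.fourierChar (inner ℝ y x) : ℂ)) (by fun_prop) 0
    simp only [inner_zero_left, AddChar.map_zero_eq_one, Circle.coe_one] at h1
    refine h1.congr fun k => ?_
    rw [SchwartzMap.fourier_coe, Real.fourier_eq, convolution_def]
    refine integral_congr_ae (Filter.Eventually.of_forall fun y => ?_)
    simp only [hbφ, ContinuousLinearMap.lsmul_apply, zero_sub, inner_neg_left, Circle.smul_def,
      smul_eq_mul, Complex.real_smul]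
    ring
  set F : ℕ → Rn n → ℂ := fun k x => (𝓕 (b k)) x * f x with hF
  have hFf : ∀ k x, ‖F k x‖ₑ ≤ ‖f x‖ₑ := fun k x => by
    rw [hF, enorm_mul]
    have h1 : ‖(𝓕 (b k)) x‖ₑ ≤ 1 := by
      rw [← ofReal_norm]
      exact ENNReal.ofReal_le_one.2 (hb1 k x)
    exact mul_le_of_le_one_left' h1
  have hspec : ∀ k ξ, 2 * δ < dist ξ ξ₀ → 𝓕 (F k) ξ = 0 := fun k ξ hξ => by
    refine fourier_mul_eq_zero hT hsupp (hbs k) ?_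
    rw [Set.disjoint_left]
    intro y hy hyΩ
    have h1 := mem_closedBall.1 (hΩ hyΩ)
    have h2 := mem_closedBall.1 hy
    have h3 : δ / (k + 1) ≤ δ := div_le_self hδ.le (by linarith [(k.cast_nonneg : (0 : ℝ) ≤ k)])
    have h4 := dist_triangle ξ y ξ₀
    rw [dist_comm ξ y] at h4
    linarith
  have hmain : ∀ k, ‖F k z‖ₑ ^ r ≤ C * ENNReal.ofReal ((1 + δ * ‖z - x‖) ^ n) *
      maximalFn (fun w => ‖f w‖ₑ ^ r) x := fun k => by
    have hFc : Continuous (F k) := (𝓕 (b k)).continuous.mul hfc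
    obtain ⟨⟨B, hB⟩, hrep⟩ := hC₀ δ hδ ξ₀ (F k) hFc (hT (𝓕 (b k))).1 (hspec k)
    refine (hC δ hδ B (fun w => ‖F k w‖ₑ) hFc.enorm.measurable hB hrep x z).trans ?_
    refine mul_le_mul_right (maximalFn_mono (fun w => ?_) x) _
    exact ENNReal.rpow_le_rpow (hFf k w) hr.le
  have ht : Filter.Tendsto (fun k => ‖F k z‖ₑ ^ r) Filter.atTop (nhds (‖f z‖ₑ ^ r)) := by
    refine (ENNReal.continuous_rpow_const.tendsto _).comp ?_
    have := ((hlim z).mul_const (f z)).enorm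
    rwa [one_mul] at this
  exact le_of_tendsto' ht hmain

/-! ### Cubes and Morrey norms. -/

lemma cube_eq_preimage (x : Rn n) (ℓ : ℝ) :
    cube x ℓ = (WithLp.ofLp : Rn n → Fin n → ℝ) ⁻¹'
      Icc (fun i => x i - ℓ / 2) (fun i => x i + ℓ / 2) := by
  ext y
  simp only [cube, mem_ofPred_eq, mem_preimage, mem_Icc, Pi.le_def, abs_le, ← forall_and]
  refine forall_congr' fun i => ?_
  constructor <;> rintro ⟨h1, h2⟩ <;> constructor <;> linarith

lemma measurableSet_cube (x : Rn n) (ℓ : ℝ) : MeasurableSet (cube x ℓ) := by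
  rw [cube_eq_preimage]
  exact measurableSet_Icc.preimage (PiLp.volume_preserving_ofLp (Fin n)).measurable

lemma volume_cube (x : Rn n) {ℓ : ℝ} (hℓ : 0 < ℓ) : volume (cube x ℓ) = ENNReal.ofReal (ℓ ^ n) := by
  rw [cube_eq_preimage, (PiLp.volume_preserving_ofLp (Fin n)).measure_preimage
    measurableSet_Icc.nullMeasurableSet, Real.volume_Icc_pi]
  have : ∀ i, x i + ℓ / 2 - (x i - ℓ / 2) = ℓ := fun i => by ring
  simp [this, ENNReal.ofReal_pow hℓ.le]

lemma cube_mono (x : Rn n) {ℓ ℓ' : ℝ} (h : ℓ ≤ ℓ') : cube x ℓ ⊆ cube x ℓ' := fun _ hy i =>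
  (hy i).trans (by linarith)

lemma ball_subset_cube {x₀ x c : Rn n} {ℓ ρ : ℝ} (hx : x ∈ cube x₀ ℓ) (hxc : x ∈ ball c ρ) :
    ball c ρ ⊆ cube x₀ (4 * ρ + ℓ) := by
  intro y hy i
  have h1 : |y i - x i| ≤ ‖y - x‖ := by simpa using PiLp.norm_apply_le (y - x) i
  have h2 : ‖y - x‖ ≤ 2 * ρ := by
    rw [← dist_eq_norm]
    have := dist_triangle_right y x c
    have h3 := mem_ball.1 hy
    have h4 := mem_ball.1 hxc
    linarith
  have h3 := abs_sub_le (y i) (x i) (x₀ i)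
  have h4 := hx i
  linarith

lemma ofReal_pow_ne_zero {ℓ : ℝ} (hℓ : 0 < ℓ) : ENNReal.ofReal (ℓ ^ n) ≠ 0 := by
  simpa using by positivity

lemma average_le_morreyNorm {p : ℝ} {φ : Rn n → ℝ → ℝ} (g : Rn n → ℝ≥0∞) (x : Rn n) {ℓ : ℝ}
    (hℓ : 0 < ℓ) (hφ : 0 < φ x ℓ) :
    ((volume (cube x ℓ))⁻¹ * ∫⁻ y in cube x ℓ, g y ^ p) ^ (1 / p) ≤
      ENNReal.ofReal (φ x ℓ) * morreyNorm p φ g := by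
  have h : (ENNReal.ofReal (φ x ℓ))⁻¹ *
      ((volume (cube x ℓ))⁻¹ * ∫⁻ y in cube x ℓ, g y ^ p) ^ (1 / p) ≤ morreyNorm p φ g :=
    le_iSup₂_of_le x ℓ (le_iSup_of_le hℓ le_rfl)
  rwa [mul_comm (ENNReal.ofReal (φ x ℓ))⁻¹, ← div_eq_mul_inv,
    ENNReal.div_le_iff (by simpa using hφ) ENNReal.ofReal_ne_top, mul_comm (morreyNorm p φ g)] at h

lemma morreyNorm_le {p : ℝ} (hp : 0 < p) {φ : Rn n → ℝ → ℝ} (hφ : ∀ x t, 0 < t → 0 < φ x t)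
    {g : Rn n → ℝ≥0∞} {B : ℝ≥0∞}
    (h : ∀ x ℓ, 0 < ℓ → ∫⁻ y in cube x ℓ, g y ^ p ≤
      ENNReal.ofReal (ℓ ^ n) * (ENNReal.ofReal (φ x ℓ) * B) ^ p) : morreyNorm p φ g ≤ B := by
  refine iSup₂_le fun x ℓ => iSup_le fun hℓ => ?_
  rw [mul_comm, ← div_eq_mul_inv, ENNReal.div_le_iff (by simpa using hφ x ℓ hℓ)
    ENNReal.ofReal_ne_top, one_div, ENNReal.rpow_inv_le_iff hp, volume_cube x hℓ,
    mul_comm, ← div_eq_mul_inv, ENNReal.div_le_iff (ofReal_pow_ne_zero hℓ) ENNReal.ofReal_ne_top,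
    mul_comm, mul_comm B]
  exact h x ℓ hℓ

lemma morreyNorm_mono {p : ℝ} (hp : 0 < p) (φ : Rn n → ℝ → ℝ) {g h : Rn n → ℝ≥0∞}
    (hgh : ∀ x, g x ≤ h x) : morreyNorm p φ g ≤ morreyNorm p φ h := by
  unfold morreyNorm
  gcongr
  exact hgh _

lemma morreyNorm_const_mul_le {p : ℝ} (hp : 0 < p) {φ : Rn n → ℝ → ℝ}
    (hφ : ∀ x t, 0 < t → 0 < φ x t) (c : ℝ≥0) (g : Rn n → ℝ≥0∞) :
    morreyNorm p φ (fun x => c * g x) ≤ c * morreyNorm p φ g := by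
  refine morreyNorm_le hp hφ fun x ℓ hℓ => ?_
  have h1 := average_le_morreyNorm (p := p) g x hℓ (hφ x ℓ hℓ)
  rw [one_div, ENNReal.rpow_inv_le_iff hp, volume_cube x hℓ, mul_comm, ← div_eq_mul_inv,
    ENNReal.div_le_iff (ofReal_pow_ne_zero hℓ) ENNReal.ofReal_ne_top] at h1
  simp_rw [ENNReal.mul_rpow_of_nonneg _ _ hp.le]
  rw [lintegral_const_mul' _ _ (by finiteness)]
  refine (mul_le_mul_right h1 _).trans_eq ?_
  rw [ENNReal.mul_rpow_of_nonneg _ _ hp.le]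
  ring

lemma weakMorreyNorm_mono {p : ℝ} (hp : 0 < p) (φ : Rn n → ℝ → ℝ) {g h : Rn n → ℝ≥0∞}
    (hgh : ∀ x, g x ≤ h x) : weakMorreyNorm p φ g ≤ weakMorreyNorm p φ h := by
  unfold weakMorreyNorm
  gcongr with T hT
  refine morreyNorm_mono hp φ fun x => ?_
  exact indicator_le_indicator_of_subset (fun y hy => lt_of_lt_of_le hy (hgh y)) (fun _ => zero_le) x

lemma weakMorreyNorm_const_mul_le {p : ℝ} (φ : Rn n → ℝ → ℝ) {c : ℝ≥0}
    (hc : 0 < c) (g : Rn n → ℝ≥0∞) :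
    weakMorreyNorm p φ (fun x => c * g x) ≤ c * weakMorreyNorm p φ g := by
  refine iSup₂_le fun T hT => ?_
  have hT' : 0 < T / c := by positivity
  have h1 : ENNReal.ofReal T = c * ENNReal.ofReal (T / c) := by
    rw [ENNReal.ofReal_div_of_pos (by exact_mod_cast hc), ENNReal.ofReal_coe_nnreal,
      ENNReal.mul_div_cancel (by exact_mod_cast hc.ne') ENNReal.coe_ne_top]
  have h2 : {x | ENNReal.ofReal T < c * g x} = {x | ENNReal.ofReal (T / c) < g x} := by
    ext x
    simp only [mem_ofPred_eq, h1]
    exact ENNReal.mul_lt_mul_iff_right (by exact_mod_cast hc.ne') ENNReal.coe_ne_top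
  rw [h2, h1, mul_assoc]
  gcongr
  exact le_iSup₂_of_le (T / c) hT' le_rfl

/-! ### The maximal operator between Morrey spaces. -/

/-- Under the supremal condition, the averages of `g ^ p` over all cubes larger than a given one
are controlled by `φ₂` of the given cube. -/
lemma SupremalCondition.exists_setLIntegral_cube_le {p r : ℝ} (hr : 0 < r) (hrp : r ≤ p)
    {φ₁ φ₂ : Rn n → ℝ → ℝ} (hφ₁ : ∀ x t, 0 < t → 0 < φ₁ x t) (hφ₂ : ∀ x t, 0 < t → 0 < φ₂ x t)
    (h : SupremalCondition p r φ₁ φ₂) :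
    ∃ A : ℝ≥0, ∀ g : Rn n → ℝ≥0∞, morreyNorm p φ₁ g ≠ ∞ → ∀ x t τ, 0 < t → t < τ →
      ∫⁻ y in cube x τ, g y ^ p ≤
        ENNReal.ofReal (τ ^ n) * (A * ENNReal.ofReal (φ₂ x t) * morreyNorm p φ₁ g) ^ p := by
  obtain ⟨A, hA⟩ := h
  have hp : 0 < p := hr.trans_le hrp
  refine ⟨A ^ (1 / r), fun g hg x t τ ht hτ => ?_⟩
  set K := morreyNorm p φ₁ g with hK
  set I := ∫⁻ y in cube x τ, g y ^ p with hI
  have hτ0 : 0 < τ := ht.trans hτ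
  -- The left side does not involve s, so the infimum over s > τ may be taken on the right.
  have hs : ∀ s, τ < s → I ^ (r / p) ≤
      K ^ r * ENNReal.ofReal (φ₁ x s ^ r * s ^ ((n : ℝ) * r / p)) := by
    intro s hs
    have hs0 : 0 < s := hτ0.trans hs
    have h1 := average_le_morreyNorm (p := p) g x hs0 (hφ₁ x s hs0)
    rw [one_div, ENNReal.rpow_inv_le_iff hp, volume_cube x hs0, mul_comm, ← div_eq_mul_inv,
      ENNReal.div_le_iff (ofReal_pow_ne_zero hs0) ENNReal.ofReal_ne_top] at h1
    have h2 : I ≤ (ENNReal.ofReal (φ₁ x s) * K) ^ p * ENNReal.ofReal (s ^ n) :=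
      (lintegral_mono_set (cube_mono x hs.le)).trans h1
    refine (ENNReal.rpow_le_rpow h2 (by positivity)).trans_eq ?_
    rw [ENNReal.mul_rpow_of_nonneg _ _ (by positivity), ← ENNReal.rpow_mul,
      mul_div_cancel₀ _ hp.ne', ENNReal.mul_rpow_of_nonneg _ _ hr.le,
      ENNReal.ofReal_rpow_of_nonneg (hφ₁ x s hs0).le hr.le,
      ENNReal.ofReal_rpow_of_nonneg (by positivity) (by positivity),
      ENNReal.ofReal_mul (Real.rpow_nonneg (hφ₁ x s hs0).le _), ← Real.rpow_natCast,
      ← Real.rpow_mul hs0.le, mul_div_assoc]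
    ring
  have hinf : I ^ (r / p) ≤ K ^ r *
      ⨅ (s : ℝ) (_ : τ < s), ENNReal.ofReal (φ₁ x s ^ r * s ^ ((n : ℝ) * r / p)) := by
    have hKt : K ^ r ≠ ∞ := ENNReal.rpow_ne_top_of_nonneg hr.le hg
    rcases eq_or_ne (K ^ r) 0 with h0 | h0
    · simpa [h0] using hs (τ + 1) (by linarith)
    · rw [← ENNReal.div_le_iff' h0 hKt]
      exact le_iInf₂ fun s hs' => ENNReal.div_le_of_le_mul' (hs s hs')
  have hτt : ENNReal.ofReal (τ ^ (-((n : ℝ) * r / p))) * ENNReal.ofReal (τ ^ ((n : ℝ) * r / p)) =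
      1 := by
    rw [← ENNReal.ofReal_mul (by positivity), ← Real.rpow_add hτ0]
    simp
  have hfin : I ^ (r / p) ≤ K ^ r * (A * ENNReal.ofReal (φ₂ x t ^ r)) *
      ENNReal.ofReal (τ ^ ((n : ℝ) * r / p)) := by
    calc I ^ (r / p) = I ^ (r / p) * ENNReal.ofReal (τ ^ (-((n : ℝ) * r / p))) *
          ENNReal.ofReal (τ ^ ((n : ℝ) * r / p)) := by rw [mul_assoc, hτt, mul_one]
      _ ≤ K ^ r * ((⨅ (s : ℝ) (_ : τ < s), ENNReal.ofReal (φ₁ x s ^ r * s ^ ((n : ℝ) * r / p))) *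
          ENNReal.ofReal (τ ^ (-((n : ℝ) * r / p)))) * ENNReal.ofReal (τ ^ ((n : ℝ) * r / p)) := by
          rw [← mul_assoc (K ^ r)]
          gcongr
      _ ≤ _ := by
          refine mul_le_mul_left (mul_le_mul_right ?_ _) _
          exact (le_iSup₂ (f := fun (τ : ℝ) (_ : t < τ) =>
            (⨅ (s : ℝ) (_ : τ < s), ENNReal.ofReal (φ₁ x s ^ r * s ^ ((n : ℝ) * r / p))) *
              ENNReal.ofReal (τ ^ (-((n : ℝ) * r / p)))) τ hτ).trans (hA x t ht)
  have hrp0 : 0 < r / p := by positivity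
  rw [← ENNReal.rpow_le_rpow_iff hrp0]
  refine hfin.trans_eq ?_
  rw [ENNReal.mul_rpow_of_nonneg _ _ hrp0.le, ← ENNReal.rpow_mul, mul_div_cancel₀ _ hp.ne',
    ENNReal.mul_rpow_of_nonneg _ _ hr.le, ENNReal.mul_rpow_of_nonneg _ _ hr.le,
    ENNReal.ofReal_rpow_of_nonneg (hφ₂ x t ht).le hr.le,
    ENNReal.ofReal_rpow_of_nonneg (by positivity) hrp0.le, ← Real.rpow_natCast,
    ← Real.rpow_mul hτ0.le, mul_div_assoc, ENNReal.coe_rpow_of_nonneg _ (by positivity),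
    ← ENNReal.rpow_mul, one_div_mul_cancel hr.ne', ENNReal.rpow_one]
  ring

/-- Hölder on the cube, keeping the same D: the large balls in M(g ^ r) see r-th powers, while the
supremal condition controls p-th powers. -/
lemma setLIntegral_cube_rpow_le {p r : ℝ} (hr : 0 < r) (hrp : r ≤ p) {g : Rn n → ℝ≥0∞}
    (hg : Measurable g) {x : Rn n} {τ : ℝ} (hτ : 0 < τ) {D : ℝ≥0∞}
    (h : ∫⁻ y in cube x τ, g y ^ p ≤ ENNReal.ofReal (τ ^ n) * D ^ p) :
    ∫⁻ y in cube x τ, g y ^ r ≤ ENNReal.ofReal (τ ^ n) * D ^ r := by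
  have hq : 1 ≤ p / r := by rwa [one_le_div hr]
  have hq0 : 0 < p / r := by linarith
  have h1 := lintegral_rpow_le_measure_univ_mul (volume.restrict (cube x τ)) hq (hg.pow_const r)
  rw [Measure.restrict_apply_univ, volume_cube x hτ] at h1
  simp_rw [← ENNReal.rpow_mul, mul_div_cancel₀ _ hr.ne'] at h1
  rw [← ENNReal.rpow_le_rpow_iff hq0]
  refine h1.trans ((mul_le_mul_right h _).trans_eq ?_)
  rw [ENNReal.mul_rpow_of_nonneg _ _ hq0.le, ← ENNReal.rpow_mul, mul_div_cancel₀ _ hr.ne',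
    ← mul_assoc]
  congr 1
  nth_rewrite 2 [← ENNReal.rpow_one (ENNReal.ofReal (τ ^ n))]
  rw [← ENNReal.rpow_add _ _ (ofReal_pow_ne_zero hτ) ENNReal.ofReal_ne_top]
  congr 1
  ring

lemma ofReal_five_mul_pow {ℓ : ℝ} :
    ENNReal.ofReal ((5 * ℓ) ^ n) = 5 ^ n * ENNReal.ofReal (ℓ ^ n) := by
  rw [mul_pow, ENNReal.ofReal_mul (by positivity), ENNReal.ofReal_pow (by norm_num)]
  norm_num

/-- Splitting of the maximal function on a cube into a local and a global part. -/
lemma maximalFn_le_max {u : Rn n → ℝ≥0∞} {x₀ x : Rn n} {ℓ : ℝ}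
    {D : ℝ≥0∞} (hD : ∀ τ, ℓ < τ → ∫⁻ y in cube x₀ τ, u y ≤ ENNReal.ofReal (τ ^ n) * D)
    (hx : x ∈ cube x₀ ℓ) :
    maximalFn u x ≤ max (maximalFn ((cube x₀ (5 * ℓ)).indicator u) x) (5 ^ n * D) := by
  refine maximalFn_le fun c ρ hρ hxc => ?_
  have hsub := ball_subset_cube hx hxc
  rcases le_total ρ ℓ with h | h
  · refine le_max_of_le_left ?_
    have hs : ball c ρ ⊆ cube x₀ (5 * ℓ) := hsub.trans (cube_mono _ (by linarith))
    refine le_trans (le_of_eq ?_) (average_le_maximalFn _ hρ hxc)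
    congr 1
    refine setLIntegral_congr_fun measurableSet_ball fun y hy => ?_
    rw [indicator_of_mem (hs hy)]
  · refine le_max_of_le_right ?_
    have hs : ball c ρ ⊆ cube x₀ (5 * ρ) := hsub.trans (cube_mono _ (by linarith))
    calc _ ≤ (ENNReal.ofReal (ρ ^ n))⁻¹ * (ENNReal.ofReal ((5 * ρ) ^ n) * D) := by
          gcongr
          exact (lintegral_mono_set hs).trans (hD _ (by linarith))
      _ = ((ENNReal.ofReal (ρ ^ n))⁻¹ * ENNReal.ofReal (ρ ^ n)) * (5 ^ n * D) := by
          rw [ofReal_five_mul_pow]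
          ring
      _ = _ := by
          rw [ENNReal.inv_mul_cancel (ofReal_pow_ne_zero hρ) ENNReal.ofReal_ne_top, one_mul]

/-- Boundedness of the maximal operator `g ↦ (M |g|^r)^{1/r}` between generalized Morrey spaces. -/
lemma SupremalCondition.exists_morreyNorm_maximalFn_le (hn : n ≠ 0) {p r : ℝ} (hr : 0 < r)
    (hrp : r < p) {φ₁ φ₂ : Rn n → ℝ → ℝ} (hφ₁ : ∀ x t, 0 < t → 0 < φ₁ x t)
    (hφ₂ : ∀ x t, 0 < t → 0 < φ₂ x t) (h : SupremalCondition p r φ₁ φ₂) :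
    ∃ C : ℝ≥0, ∀ g : Rn n → ℝ≥0∞, Measurable g → morreyNorm p φ₁ g ≠ ∞ →
      morreyNorm p φ₂ (fun x => maximalFn (fun y => g y ^ r) x ^ (1 / r)) ≤
        C * morreyNorm p φ₁ g := by
  have hp : 0 < p := hr.trans hrp
  have hq : 1 < p / r := by rwa [one_lt_div hr]
  have hq0 : 0 < p / r := by linarith
  obtain ⟨A, hA⟩ := h.exists_setLIntegral_cube_le hr hrp.le hφ₁ hφ₂
  obtain ⟨Cq, hCq⟩ := exists_lintegral_maximalFn_rpow_le hn hq
  -- The first summand comes from the local part (strong type on the fivefold cube), the second from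
  -- the large balls.
  set c : ℝ≥0 := Cq * 5 ^ n + (5 ^ n) ^ (p / r) with hc
  refine ⟨c ^ (1 / p) * A, fun g hgm hg => morreyNorm_le hp hφ₂ fun x₀ ℓ hℓ => ?_⟩
  set D := A * ENNReal.ofReal (φ₂ x₀ ℓ) * morreyNorm p φ₁ g with hDdef
  have hD := fun τ hτ => hA g hg x₀ ℓ τ hℓ hτ
  rw [← hDdef] at hD
  have hDr : ∀ τ, ℓ < τ → ∫⁻ y in cube x₀ τ, g y ^ r ≤ ENNReal.ofReal (τ ^ n) * D ^ r :=
    fun τ hτ => setLIntegral_cube_rpow_le hr hrp.le hgm (hℓ.trans hτ) (hD τ hτ)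
  set u : Rn n → ℝ≥0∞ := fun y => g y ^ r with hu
  have hum : Measurable u := hgm.pow_const r
  set v := (cube x₀ (5 * ℓ)).indicator u with hv
  have hvm : Measurable v := hum.indicator (measurableSet_cube _ _)
  have hvint : ∫⁻ y, v y ^ (p / r) ≤ 5 ^ n * ENNReal.ofReal (ℓ ^ n) * D ^ p := by
    rw [← ofReal_five_mul_pow]
    refine le_trans (le_of_eq ?_) (hD (5 * ℓ) (by linarith))
    rw [← lintegral_indicator (measurableSet_cube _ _)]
    refine lintegral_congr fun y => ?_
    by_cases hy : y ∈ cube x₀ (5 * ℓ)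
    · simp only [hv, indicator_of_mem hy, hu]
      rw [← ENNReal.rpow_mul, mul_div_cancel₀ _ hr.ne']
    · simp only [hv, indicator_of_notMem hy]
      exact ENNReal.zero_rpow_of_pos hq0
  calc ∫⁻ y in cube x₀ ℓ, (maximalFn u y ^ (1 / r)) ^ p
      ≤ ∫⁻ y in cube x₀ ℓ, (maximalFn v y ^ (p / r) + (5 ^ n * D ^ r) ^ (p / r)) := by
        refine setLIntegral_mono' (measurableSet_cube _ _) fun y hy => ?_
        rw [← ENNReal.rpow_mul, one_div_mul_eq_div]
        refine (ENNReal.rpow_le_rpow (maximalFn_le_max hDr hy) hq0.le).trans ?_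
        rcases le_total (maximalFn v y) (5 ^ n * D ^ r) with h' | h'
        · rw [max_eq_right h']; exact le_add_self
        · rw [max_eq_left h']; exact le_self_add
    _ ≤ Cq * (5 ^ n * ENNReal.ofReal (ℓ ^ n) * D ^ p) +
          (5 ^ n * D ^ r) ^ (p / r) * ENNReal.ofReal (ℓ ^ n) := by
        rw [lintegral_add_right _ measurable_const, setLIntegral_const, volume_cube _ hℓ]
        gcongr
        exact (setLIntegral_le_lintegral _ _).trans ((hCq v hvm).trans (by gcongr))
    _ = ENNReal.ofReal (ℓ ^ n) * (c * D ^ p) := by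
        rw [ENNReal.mul_rpow_of_nonneg _ _ hq0.le, ← ENNReal.rpow_mul, mul_div_cancel₀ _ hr.ne', hc]
        push_cast
        rw [ENNReal.coe_rpow_of_nonneg _ hq0.le]
        push_cast
        ring
    _ = _ := by
        have h1 : ENNReal.ofReal (φ₂ x₀ ℓ) * ((c ^ (1 / p) * A : ℝ≥0) * morreyNorm p φ₁ g) =
            (c : ℝ≥0∞) ^ (1 / p) * D := by
          rw [hDdef, ENNReal.coe_mul, ENNReal.coe_rpow_of_nonneg _ (by positivity)]
          ring
        rw [h1, ENNReal.mul_rpow_of_nonneg _ D hp.le, ← ENNReal.rpow_mul, one_div_mul_cancel hp.ne',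
          ENNReal.rpow_one]

/-- Weak boundedness of the maximal operator `g ↦ (M |g|^r)^{1/r}` in the endpoint case. -/
lemma SupremalCondition.exists_weakMorreyNorm_maximalFn_le (hn : n ≠ 0) {r : ℝ} (hr : 0 < r)
    {φ₁ φ₂ : Rn n → ℝ → ℝ} (hφ₁ : ∀ x t, 0 < t → 0 < φ₁ x t)
    (hφ₂ : ∀ x t, 0 < t → 0 < φ₂ x t) (h : SupremalCondition r r φ₁ φ₂) :
    ∃ C : ℝ≥0, ∀ g : Rn n → ℝ≥0∞, morreyNorm r φ₁ g ≠ ∞ →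
      weakMorreyNorm r φ₂ (fun x => maximalFn (fun y => g y ^ r) x ^ (1 / r)) ≤
        C * morreyNorm r φ₁ g := by
  obtain ⟨A, hA⟩ := h.exists_setLIntegral_cube_le hr le_rfl hφ₁ hφ₂
  have hκ' : volume (ball (0 : Rn n) 1) ≠ ∞ := measure_ball_lt_top.ne
  lift volume (ball (0 : Rn n) 1) to ℝ≥0 using hκ' with κ hκ
  set c : ℝ≥0 := 5 ^ n + 5 ^ n * κ * 5 ^ n with hc
  refine ⟨c ^ (1 / r) * A, fun g hg => iSup₂_le fun T hT => ?_⟩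
  have hT0 : ENNReal.ofReal T ≠ 0 := by simpa using hT
  rw [mul_comm, ← ENNReal.le_div_iff_mul_le (.inl hT0) (.inl ENNReal.ofReal_ne_top)]
  refine morreyNorm_le hr hφ₂ fun x₀ ℓ hℓ => ?_
  set D := A * ENNReal.ofReal (φ₂ x₀ ℓ) * morreyNorm r φ₁ g with hDdef
  have hD : ∀ τ, ℓ < τ → ∫⁻ y in cube x₀ τ, g y ^ r ≤ ENNReal.ofReal (τ ^ n) * D ^ r :=
    fun τ hτ => hA g hg x₀ ℓ τ hℓ hτ
  set u : Rn n → ℝ≥0∞ := fun y => g y ^ r with hu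
  set E := {x | ENNReal.ofReal T < maximalFn u x ^ (1 / r)} with hE
  set lam := ENNReal.ofReal T ^ r with hlam
  have hlam0 : lam ≠ 0 := by
    simp only [hlam, ne_eq, ENNReal.rpow_eq_zero_iff_of_pos hr]; exact hT0
  have hlamt : lam ≠ ∞ := ENNReal.rpow_ne_top_of_nonneg hr.le ENNReal.ofReal_ne_top
  have hEm : ∀ x, x ∈ E ↔ lam < maximalFn u x := fun x => by
    simp only [hE, mem_ofPred_eq, hlam, one_div]
    exact ENNReal.lt_rpow_inv_iff hr
  have hEms : MeasurableSet E := by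
    have : E = {x | lam < maximalFn u x} := Set.ext hEm
    rw [this]
    exact (isOpen_lt_maximalFn u lam).measurableSet
  have hind : ∫⁻ y in cube x₀ ℓ, E.indicator (fun _ => (1 : ℝ≥0∞)) y ^ r =
      volume (E ∩ cube x₀ ℓ) := by
    rw [← Measure.restrict_apply hEms, ← lintegral_indicator_one hEms]
    refine lintegral_congr fun y => ?_
    by_cases hy : y ∈ E
    · simp [indicator_of_mem hy]
    · simp [indicator_of_notMem hy, hr]
  have hmain : lam * volume (E ∩ cube x₀ ℓ) ≤ ENNReal.ofReal (ℓ ^ n) * (c * D ^ r) := by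
    -- At low levels the volume of the cube suffices. Above 5 ^ n * D ^ r the large balls cannot
    -- reach the level, so only the local part counts.
    rcases le_or_gt lam (5 ^ n * D ^ r) with h' | h'
    · calc _ ≤ (5 ^ n * D ^ r) * ENNReal.ofReal (ℓ ^ n) := by
            rw [← volume_cube x₀ hℓ]
            gcongr
            exact inter_subset_right
        _ ≤ (5 ^ n * D ^ r) * ENNReal.ofReal (ℓ ^ n) +
            5 ^ n * κ * 5 ^ n * D ^ r * ENNReal.ofReal (ℓ ^ n) := le_self_add
        _ = _ := by rw [hc]; push_cast; ring
    · have hsub : E ∩ cube x₀ ℓ ⊆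
          {x | lam < maximalFn ((cube x₀ (5 * ℓ)).indicator u) x} := fun x ⟨hxE, hxQ⟩ => by
        have h1 := ((hEm x).1 hxE).trans_le (maximalFn_le_max hD hxQ)
        exact (lt_max_iff.1 h1).resolve_right h'.not_gt
      calc _ ≤ lam * volume {x | lam < maximalFn ((cube x₀ (5 * ℓ)).indicator u) x} := by gcongr
        _ ≤ 5 ^ n * κ * ∫⁻ y in cube x₀ (5 * ℓ), u y := by
            rw [← lintegral_indicator (measurableSet_cube _ _), hκ]
            exact mul_volume_lt_maximalFn_le hn _ _
        _ ≤ 5 ^ n * κ * (5 ^ n * ENNReal.ofReal (ℓ ^ n) * D ^ r) := by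
            gcongr
            rw [← ofReal_five_mul_pow]
            exact hD _ (by linarith)
        _ ≤ (5 ^ n * D ^ r) * ENNReal.ofReal (ℓ ^ n) +
            5 ^ n * κ * (5 ^ n * ENNReal.ofReal (ℓ ^ n) * D ^ r) := le_add_self
        _ = _ := by rw [hc]; push_cast; ring
  rw [hind]
  have h1 : ENNReal.ofReal (φ₂ x₀ ℓ) * ((c ^ (1 / r) * A : ℝ≥0) * morreyNorm r φ₁ g /
      ENNReal.ofReal T) = (c : ℝ≥0∞) ^ (1 / r) * D / ENNReal.ofReal T := by
    rw [hDdef, ENNReal.coe_mul, ENNReal.coe_rpow_of_nonneg _ (by positivity)]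
    simp only [div_eq_mul_inv]
    ring
  rw [h1, ENNReal.div_rpow_of_nonneg _ _ hr.le, ENNReal.mul_rpow_of_nonneg _ D hr.le,
    ← ENNReal.rpow_mul, one_div_mul_cancel hr.ne', ENNReal.rpow_one, ← mul_div_assoc,
    ENNReal.le_div_iff_mul_le (.inl hlam0) (.inl hlamt), mul_comm]
  exact hmain

/-! ### Choice of scale and the pointwise bound for the Peetre maximal function. -/

/-- For d > 0 the scale is d. For d = 0 the spectrum is at most one point and fits in balls of every
radius, so δ may depend on s = |y|; taking δ = 1 / (s + 1) keeps δ s ≤ 1. -/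
lemma exists_scale_rpow_le {a d : ℝ} (ha : 0 ≤ a) (hd : 0 ≤ d) :
    ∃ C : ℝ≥0, 0 < C ∧ ∀ s : ℝ, 0 ≤ s → ∃ δ : ℝ, 0 < δ ∧ d ≤ δ ∧
      (1 + δ * s) ^ a ≤ C * (1 + d * s ^ a) := by
  rcases hd.eq_or_lt with rfl | hd
  · refine ⟨2 ^ a, by positivity, fun s hs => ⟨1 / (s + 1), by positivity, by positivity, ?_⟩⟩
    rw [zero_mul, add_zero, mul_one, NNReal.coe_rpow]
    refine Real.rpow_le_rpow (by positivity) ?_ ha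
    have : 1 / (s + 1) * s ≤ 1 := by
      rw [one_div, inv_mul_le_iff₀ (by positivity)]; linarith
    norm_num
    norm_num at this
    linarith
  · refine ⟨⟨2 ^ a * (1 + d ^ a / d), by positivity⟩, ?_, fun s hs => ⟨d, hd, le_rfl, ?_⟩⟩
    · have : (0 : ℝ) < 2 ^ a * (1 + d ^ a / d) := by positivity
      exact_mod_cast this
    · have h1 : (1 + d * s) ^ a ≤ 2 ^ a * (1 + d ^ a * s ^ a) := by
        calc (1 + d * s) ^ a ≤ (2 * max 1 (d * s)) ^ a := by
              refine Real.rpow_le_rpow (by positivity) ?_ ha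
              have := le_max_left 1 (d * s)
              have := le_max_right 1 (d * s)
              linarith
          _ = 2 ^ a * max 1 (d * s) ^ a := Real.mul_rpow (by norm_num) (by positivity)
          _ ≤ _ := by
              gcongr
              have h2 : 0 ≤ d ^ a * s ^ a := by positivity
              rcases le_total 1 (d * s) with h | h
              · rw [max_eq_right h, Real.mul_rpow hd.le hs]; linarith
              · rw [max_eq_left h, Real.one_rpow]; linarith
      refine h1.trans ?_
      change _ ≤ 2 ^ a * (1 + d ^ a / d) * (1 + d * s ^ a)
      rw [mul_assoc]
      gcongr
      have h3 : d ^ a / d * (d * s ^ a) = d ^ a * s ^ a := by field_simp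
      have h4 : 0 ≤ d ^ a / d := by positivity
      have h5 : 0 ≤ d * s ^ a := by positivity
      nlinarith

/-- The Peetre maximal function is pointwise dominated by the Hardy–Littlewood maximal function. -/
lemma exists_peetreMaximal_le (n : ℕ) {r d : ℝ} (hr : 0 < r) (hd : 0 ≤ d) :
    ∃ C : ℝ≥0, 0 < C ∧ ∀ Ω : Set (Rn n), IsCompact Ω → diam Ω = d → ∀ f : Rn n → ℂ,
      IsBandLimited Ω f →
      ∀ x, peetreMaximal d r f x ≤ C * maximalFn (fun y => ‖f y‖ₑ ^ r) x ^ (1 / r) := by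
  obtain ⟨C₁, hC₁⟩ := IsBandLimited.exists_rpow_le_maximalFn n hr
  obtain ⟨C₂, hC₂, hscale⟩ := exists_scale_rpow_le (a := n / r) (by positivity) hd
  -- Adding 1 makes the constant positive, as rescaling the level in the weak norm requires.
  refine ⟨(C₁ + 1) ^ (1 / r) * C₂, by positivity, fun Ω hΩ hΩd f hf x => iSup_le fun y => ?_⟩
  obtain ⟨δ, hδ, hdδ, hs⟩ := hscale ‖y‖ (norm_nonneg y)
  obtain ⟨ξ₀, hξ₀⟩ : ∃ ξ₀, Ω ⊆ closedBall ξ₀ δ := by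
    rcases Ω.eq_empty_or_nonempty with rfl | ⟨ξ₀, hξ₀⟩
    · exact ⟨0, empty_subset _⟩
    · exact ⟨ξ₀, fun ξ hξ => (dist_le_diam_of_mem hΩ.isBounded hξ hξ₀).trans (hΩd.le.trans hdδ)⟩
  have h1 := hC₁ δ hδ ξ₀ Ω hξ₀ f hf x (x - y)
  rw [sub_sub_cancel_left, norm_neg] at h1
  set M := maximalFn (fun y => ‖f y‖ₑ ^ r) x with hM
  have hpos : 0 < 1 + d * ‖y‖ ^ ((n : ℝ) / r) := by positivity
  rw [ENNReal.ofReal_div_of_pos hpos, ofReal_norm]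
  refine ENNReal.div_le_of_le_mul ?_
  calc ‖f (x - y)‖ₑ ≤ (C₁ * ENNReal.ofReal ((1 + δ * ‖y‖) ^ n) * M) ^ (1 / r) := by
        rw [one_div, ENNReal.le_rpow_inv_iff hr]; exact h1
    _ = (C₁ : ℝ≥0∞) ^ (1 / r) * ENNReal.ofReal ((1 + δ * ‖y‖) ^ ((n : ℝ) / r)) * M ^ (1 / r) := by
        rw [ENNReal.mul_rpow_of_nonneg _ _ (by positivity),
          ENNReal.mul_rpow_of_nonneg _ _ (by positivity),
          ENNReal.ofReal_rpow_of_nonneg (by positivity) (by positivity), ← Real.rpow_natCast,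
          ← Real.rpow_mul (by positivity), mul_one_div]
    _ ≤ ((C₁ + 1 : ℝ≥0) : ℝ≥0∞) ^ (1 / r) *
          ENNReal.ofReal (C₂ * (1 + d * ‖y‖ ^ ((n : ℝ) / r))) * M ^ (1 / r) := by
        gcongr
        exact le_self_add
    _ = _ := by
        rw [ENNReal.ofReal_mul (by positivity), ENNReal.ofReal_coe_nnreal, ENNReal.coe_mul,
          ENNReal.coe_rpow_of_nonneg _ (by positivity)]
        ring

end GenMorrey

end

theorem mainTheorem9 (n : ℕ) (hn : 1 ≤ n) (p r : ℝ) (hr : 0 < r) (hrp : r ≤ p)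
    (φ₁ φ₂ : GenMorrey.Rn n → ℝ → ℝ)
    (hφ₁ : ∀ x t, 0 < t → 0 < φ₁ x t) (hφ₂ : ∀ x t, 0 < t → 0 < φ₂ x t)
    (hφ : GenMorrey.SupremalCondition p r φ₁ φ₂) (d : ℝ) :
    ∃ C : ℝ≥0, ∀ Ω : Set (GenMorrey.Rn n), IsCompact Ω → Metric.diam Ω = d →
      ∀ f : GenMorrey.Rn n → ℂ, GenMorrey.MemMorrey p φ₁ f → GenMorrey.IsBandLimited Ω f →
        (r < p →
          GenMorrey.morreyNorm p φ₂ (GenMorrey.peetreMaximal d r f) ≤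
            C * GenMorrey.morreyNorm p φ₁ (fun x => ‖f x‖ₑ)) ∧
        (p = r →
          GenMorrey.weakMorreyNorm r φ₂ (GenMorrey.peetreMaximal d r f) ≤
            C * GenMorrey.morreyNorm r φ₁ (fun x => ‖f x‖ₑ)) := by
  have hn0 : n ≠ 0 := by omega
  have hp : 0 < p := hr.trans_le hrp
  rcases lt_or_ge d 0 with hd | hd
  -- No set has negative diameter.
  · exact ⟨0, fun Ω _ hΩ => absurd (hΩ ▸ Metric.diam_nonneg) hd.not_ge⟩
  obtain ⟨C₁, hC₁, hpeetre⟩ := GenMorrey.exists_peetreMaximal_le n hr hd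
  rcases hrp.eq_or_lt with rfl | hlt
  · obtain ⟨C, hC⟩ := hφ.exists_weakMorreyNorm_maximalFn_le hn0 hr hφ₁ hφ₂
    refine ⟨C₁ * C, fun Ω hΩ hΩd f hfM hf => ⟨fun h => absurd h (lt_irrefl _), fun _ => ?_⟩⟩
    refine (GenMorrey.weakMorreyNorm_mono hr φ₂ (hpeetre Ω hΩ hΩd f hf)).trans ?_
    refine (GenMorrey.weakMorreyNorm_const_mul_le φ₂ hC₁ _).trans ?_
    rw [ENNReal.coe_mul, mul_assoc]
    exact mul_le_mul_right (hC _ hfM.2.ne) _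
  · obtain ⟨C, hC⟩ := hφ.exists_morreyNorm_maximalFn_le hn0 hr hlt hφ₁ hφ₂
    refine ⟨C₁ * C, fun Ω hΩ hΩd f hfM hf => ⟨fun _ => ?_, fun h => absurd h hlt.ne'⟩⟩
    refine (GenMorrey.morreyNorm_mono hp φ₂ (hpeetre Ω hΩ hΩd f hf)).trans ?_
    refine (GenMorrey.morreyNorm_const_mul_le hp hφ₂ C₁ _).trans ?_
    rw [ENNReal.coe_mul, mul_assoc]
    exact mul_le_mul_right (hC _ hf.1.enorm.measurable hfM.2.ne) _
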